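/- All signatures contain equality; formulas are first-order formulas. Let $T_I$ be a one-sorted theory (sort $\mathtt{INDEX}$) in a signature $\Sigma$ that contains a binary relation symbol $\le$ and a constant $0$. The signature is effectively presented: its function and relation symbols are coded by natural numbers, with computable arities. A quantifier-free formula is $T$-satisfiable if it is true in some model of $T$ under some assignment to its variables, and $SMT(T)$ is the problem of deciding whether a given quantifier-free formula in the signature of $T$ is $T$-satisfiable. The theory $T_I$ is an *index theory* if 1. all its axioms are universal sentences; 2. it is stably infinite: every $T_I$-satisfiable quantifier-free formula is satisfiable in an infinite model of $T_I$; 3. it has the general quantifier-free interpolation property: for every signature $\Sigma'$ disjoint from $\Sigma$ and all ground quantifier-free $\Sigma\cup\Sigma'$-formulas $\phi,\psi$ such that $\phi\wedge\psi$ is false in every $\Sigma\cup\Sigma'$-structure whose $\Sigma$-reduct is a model of $T_I$, there is a ground quantifier-free formula $\theta$ such that, in all these structures, $\phi\to\theta$ is true and $\theta\wedge\psi$ is false, and every symbol of $\Sigma'$ occurring in $\theta$ occurs both in $\phi$ and in $\psi$; 4. $SMT(T_I)$ is decidable; 5. $T_I$ entails that $\le$ is reflexive, transitive, antisymmetric and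 total. Given an index theory $T_I$, the theory $\mathcal{ARD}(T_I)$ of arrays with maxdiff has the sorts $\mathtt{ARRAY},\mathtt{ELEM},\mathtt{INDEX}$, the symbols of $T_I$ on the sort $\mathtt{INDEX}$, and the symbols $$rd:\mathtt{ARRAY}\times\mathtt{INDEX}\to\mathtt{ELEM},\quad wr:\mathtt{ARRAY}\times\mathtt{INDEX}\times\mathtt{ELEM}\to\mathtt{ARRAY},\quad \mathrm{diff}:\mathtt{ARRAY}\times\mathtt{ARRAY}\to\mathtt{INDEX},\quad \varepsilon:\mathtt{ARRAY},\quad \bot:\mathtt{ELEM}.$$ Its axioms are those of $T_I$ together with the universal closures of the following, where $i<j$ abbreviates $i\le j\wedge i\ne j$: $$\begin{aligned} &0\le i\to rd(wr(y,i,e),i)=e, && i\ne j\to rd(wr(y,i,e),j)=rd(y,j),\\ &x\ne y\to rd(x,\mathrm{diff}(x,y))\ne rd(y,\mathrm{diff}(x,y)), && \mathrm{diff}(x,y)<i\to rd(x,i)=rd(y,i),\\ &\mathrm{diff}(x,x)=0, && i<0\to rd(x,i)=\bot,\\ &rd(\varepsilon,i)=\bot. && \end{aligned}$$ **Theorem.**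 For every index theory $T_I$, the problem $SMT(\mathcal{ARD}(T_I))$ is decidable: the set of quantifier-free formulas, with variables of all three sorts, that are $\mathcal{ARD}(T_I)$-satisfiable is recursive. -/

import Mathlib

namespace MaxDiff

open FirstOrder FirstOrder.Language

/-! ## Words over an effectively presented alphabet

Quantifier-free formulas are written in prefix notation as finite words over the alphabet
`Symbol L`, where `L` is the signature of the index theory.  The alphabet is shared by the formulas
over `L` and by the formulas of the array theory, so that a formula over `L` is written in the same
way in both. -/

/-- The symbols from which formulas are written: variables of the three sorts, the function and
relation symbols of `L`, the array symbols, and the logical symbols.  (`boundVar` and `all` are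
only used in formulas with quantifiers.) -/
inductive Symbol (L : FirstOrder.Language.{0, 0}) : Type
  | arrayVar (n : ℕ)
  | elemVar (n : ℕ)
  | indexVar (n : ℕ)
  | boundVar (n : ℕ)
  | fn (f : Σ n, L.Functions n)
  | rel (R : Σ n, L.Relations n)
  | eps
  | bot
  | rd
  | wr
  | diff
  | falsum
  | eq
  | imp
  | all

/-- The alphabet as a disjoint sum, which gives its coding by natural numbers. -/
def Symbol.equivSum (L : FirstOrder.Language.{0, 0}) :
    Symbol L ≃ (ℕ ⊕ ℕ ⊕ ℕ ⊕ ℕ) ⊕ (Σ n, L.Functions n) ⊕ (Σ n, L.Relations n) ⊕ Fin 9 where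
  toFun
    | .arrayVar n => .inl (.inl n)
    | .elemVar n => .inl (.inr (.inl n))
    | .indexVar n => .inl (.inr (.inr (.inl n)))
    | .boundVar n => .inl (.inr (.inr (.inr n)))
    | .fn f => .inr (.inl f)
    | .rel R => .inr (.inr (.inl R))
    | .eps => .inr (.inr (.inr 0))
    | .bot => .inr (.inr (.inr 1))
    | .rd => .inr (.inr (.inr 2))
    | .wr => .inr (.inr (.inr 3))
    | .diff => .inr (.inr (.inr 4))
    | .falsum => .inr (.inr (.inr 5))
    | .eq => .inr (.inr (.inr 6))
    | .imp => .inr (.inr (.inr 7))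
    | .all => .inr (.inr (.inr 8))
  invFun
    | .inl (.inl n) => .arrayVar n
    | .inl (.inr (.inl n)) => .elemVar n
    | .inl (.inr (.inr (.inl n))) => .indexVar n
    | .inl (.inr (.inr (.inr n))) => .boundVar n
    | .inr (.inl f) => .fn f
    | .inr (.inr (.inl R)) => .rel R
    | .inr (.inr (.inr 0)) => .eps
    | .inr (.inr (.inr 1)) => .bot
    | .inr (.inr (.inr 2)) => .rd
    | .inr (.inr (.inr 3)) => .wr
    | .inr (.inr (.inr 4)) => .diff
    | .inr (.inr (.inr 5)) => .falsum
    | .inr (.inr (.inr 6)) => .eq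
    | .inr (.inr (.inr 7)) => .imp
    | .inr (.inr (.inr 8)) => .all
  left_inv s := by cases s <;> rfl
  right_inv x := by
    rcases x with (n | n | n | n) | f | R | k
    all_goals first | rfl | (fin_cases k <;> rfl)

instance (L : FirstOrder.Language.{0, 0}) [Primcodable (Σ n, L.Functions n)]
    [Primcodable (Σ n, L.Relations n)] : Primcodable (Symbol L) :=
  Primcodable.ofEquiv _ (Symbol.equivSum L)

/-! ## Index theories -/

section IndexTheory

variable {L : FirstOrder.Language.{0, 0}}

/-- A term over `L` as a word. -/
def termWord {n : ℕ} : L.Term (ℕ ⊕ Fin n) → List (Symbol L)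
  | .var (.inl m) => [.indexVar m]
  | .var (.inr k) => [.boundVar k]
  | .func f ts => .fn ⟨_, f⟩ :: (List.finRange _).flatMap fun i => termWord (ts i)

/-- A formula over `L`, with free variables indexed by `ℕ`, as a word. -/
def formulaWord {n : ℕ} : L.BoundedFormula ℕ n → List (Symbol L)
  | .falsum => [.falsum]
  | .equal t u => .eq :: (termWord t ++ termWord u)
  | .rel R ts => .rel ⟨_, R⟩ :: (List.finRange _).flatMap fun i => termWord (ts i)
  | .imp φ ψ => .imp :: (formulaWord φ ++ formulaWord ψ)
  | .all φ => .all :: formulaWord φ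

/-- `φ` is `T`-satisfiable: true in some model of `T` under some assignment. -/
def FormulaSat (T : L.Theory) (φ : L.Formula ℕ) : Prop :=
  ∃ (M : Theory.ModelType.{0, 0, 0} T) (v : ℕ → M), φ.Realize v

/-- `φ` is satisfiable in some infinite model of `T`. -/
def FormulaSatInfinite (T : L.Theory) (φ : L.Formula ℕ) : Prop :=
  ∃ M : Theory.ModelType.{0, 0, 0} T, Infinite M ∧ ∃ v : ℕ → M, φ.Realize v

/-- `T` is stably infinite. -/
def StablyInfinite (T : L.Theory) : Prop :=
  ∀ φ : L.Formula ℕ, φ.IsQF → FormulaSat T φ → FormulaSatInfinite T φ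

/-- The satisfiability problem modulo `T` for quantifier-free formulas over `L` is decidable: the
set of words that denote a `T`-satisfiable quantifier-free formula is recursive. -/
def SMTDecidable [Primcodable (Σ n, L.Functions n)] [Primcodable (Σ n, L.Relations n)]
    (T : L.Theory) : Prop :=
  ComputablePred fun w : List (Symbol L) =>
    ∃ φ : L.Formula ℕ, φ.IsQF ∧ formulaWord φ = w ∧ FormulaSat T φ

/-- The function symbols (including constants) that occur in a term. -/
def termFunctions {α : Type} : L.Term α → Set (Σ n, L.Functions n)
  | .var _ => ∅
  | .func f ts => {⟨_, f⟩} ∪ ⋃ i, termFunctions (ts i)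

/-- The function symbols (including constants) that occur in a formula. -/
def formulaFunctions {α : Type} {n : ℕ} : L.BoundedFormula α n → Set (Σ n, L.Functions n)
  | .falsum => ∅
  | .equal t u => termFunctions t ∪ termFunctions u
  | .rel _ ts => ⋃ i, termFunctions (ts i)
  | .imp φ ψ => formulaFunctions φ ∪ formulaFunctions ψ
  | .all φ => formulaFunctions φ

/-- The relation symbols that occur in a formula. -/
def formulaRelations {α : Type} {n : ℕ} : L.BoundedFormula α n → Set (Σ n, L.Relations n)
  | .falsum => ∅
  | .equal _ _ => ∅
  | .rel R _ => {⟨_, R⟩}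
  | .imp φ ψ => formulaRelations φ ∪ formulaRelations ψ
  | .all φ => formulaRelations φ

/-- All symbols of the additional signature `L'` that occur in `θ` occur in `φ`. -/
def FreeSymbolsSubset {L' : FirstOrder.Language.{0, 0}} (θ φ : (L.sum L').Sentence) : Prop :=
  (∀ (n : ℕ) (f : L'.Functions n),
    (⟨n, Sum.inr f⟩ : Σ n, (L.sum L').Functions n) ∈ formulaFunctions θ →
      (⟨n, Sum.inr f⟩ : Σ n, (L.sum L').Functions n) ∈ formulaFunctions φ) ∧
  (∀ (n : ℕ) (R : L'.Relations n),
    (⟨n, Sum.inr R⟩ : Σ n, (L.sum L').Relations n) ∈ formulaRelations θ →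
      (⟨n, Sum.inr R⟩ : Σ n, (L.sum L').Relations n) ∈ formulaRelations φ)

/-- `T`, viewed as a theory in the signature expanded by the free symbols of `L'`: its models are
the structures whose `L`-reduct is a model of `T`. -/
def expand (T : L.Theory) (L' : FirstOrder.Language.{0, 0}) : (L.sum L').Theory :=
  (LHom.sumInl : L →ᴸ L.sum L').onTheory T

/-- The general quantifier-free interpolation property: for every signature `L'` disjoint from `L`
and all ground formulas `φ`, `ψ` over the union whose conjunction is `T`-unsatisfiable there is a
ground formula `θ` that is `T`-entailed by `φ`, is `T`-unsatisfiable together with `ψ`, and in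
which only those symbols of `L'` occur that occur in both `φ` and `ψ`. -/
def GeneralQFInterpolation (T : L.Theory) : Prop :=
  ∀ (L' : FirstOrder.Language.{0, 0}) (φ ψ : (L.sum L').Sentence), φ.IsQF → ψ.IsQF →
    ¬ (expand T L' ∪ {φ, ψ}).IsSatisfiable →
    ∃ θ : (L.sum L').Sentence, θ.IsQF ∧
      expand T L' ⊨ᵇ φ.imp θ ∧
      ¬ (expand T L' ∪ {θ, ψ}).IsSatisfiable ∧
      FreeSymbolsSubset θ φ ∧ FreeSymbolsSubset θ ψ

/-- Index theories, in a signature with a binary relation symbol `≤`.  (The signature also has a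
distinguished constant `0`, on which no axiom is imposed.) -/
structure IsIndexTheory [L.IsOrdered] [Primcodable (Σ n, L.Functions n)]
    [Primcodable (Σ n, L.Relations n)] (T : L.Theory) : Prop where
  universal : T.IsUniversal
  stablyInfinite : StablyInfinite T
  interpolation : GeneralQFInterpolation T
  smtDecidable : SMTDecidable T
  linearOrder : ∀ φ ∈ L.linearOrderTheory, T ⊨ᵇ φ

end IndexTheory

/-! ## Arrays with maxdiff -/

section Arrays

/-- The three sorts. -/
inductive ASort : Type
  | array
  | elem
  | index

/-- Terms of the array theory over the index signature `L`, by sort. -/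
inductive ATerm (L : FirstOrder.Language.{0, 0}) : ASort → Type
  | var (s : ASort) (n : ℕ) : ATerm L s
  | fn {n : ℕ} (f : L.Functions n) (ts : Fin n → ATerm L .index) : ATerm L .index
  | eps : ATerm L .array
  | bot : ATerm L .elem
  | rd (a : ATerm L .array) (i : ATerm L .index) : ATerm L .elem
  | wr (a : ATerm L .array) (i : ATerm L .index) (e : ATerm L .elem) : ATerm L .array
  | diff (a b : ATerm L .array) : ATerm L .index

/-- Quantifier-free formulas of the array theory; the other connectives are definable from
falsity and implication. -/
inductive AFormula (L : FirstOrder.Language.{0, 0}) : Type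
  | falsum : AFormula L
  | eq {s : ASort} (t u : ATerm L s) : AFormula L
  | rel {n : ℕ} (R : L.Relations n) (ts : Fin n → ATerm L .index) : AFormula L
  | imp (φ ψ : AFormula L) : AFormula L

variable {L : FirstOrder.Language.{0, 0}}

/-- The symbol for the `n`-th variable of a sort. -/
def varSymbol : ASort → ℕ → Symbol L
  | .array, n => .arrayVar n
  | .elem, n => .elemVar n
  | .index, n => .indexVar n

/-- A term of the array theory as a word. -/
def ATerm.word {s : ASort} : ATerm L s → List (Symbol L)
  | .var s n => [varSymbol s n]
  | .fn f ts => .fn ⟨_, f⟩ :: (List.finRange _).flatMap fun i => (ts i).word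
  | .eps => [.eps]
  | .bot => [.bot]
  | .rd a i => .rd :: (a.word ++ i.word)
  | .wr a i e => .wr :: (a.word ++ i.word ++ e.word)
  | .diff a b => .diff :: (a.word ++ b.word)

/-- A quantifier-free formula of the array theory as a word. -/
def AFormula.word : AFormula L → List (Symbol L)
  | .falsum => [.falsum]
  | .eq t u => .eq :: (t.word ++ u.word)
  | .rel R ts => .rel ⟨_, R⟩ :: (List.finRange _).flatMap fun i => (ts i).word
  | .imp φ ψ => .imp :: (φ.word ++ ψ.word)

variable (L) in
/-- Three-sorted structures for the signature of the array theory. -/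
structure AStructure where
  /-- the sort `ARRAY` -/
  Array : Type
  /-- the sort `ELEM` -/
  Elem : Type
  /-- the sort `INDEX` -/
  Index : Type
  [str : L.Structure Index]
  rd : Array → Index → Elem
  wr : Array → Index → Elem → Array
  diff : Array → Array → Index
  eps : Array
  bot : Elem

attribute [instance] AStructure.str

namespace AStructure

/-- The carrier of a sort. -/
def carrier (M : AStructure L) : ASort → Type
  | .array => M.Array
  | .elem => M.Elem
  | .index => M.Index

/-- The value of a term under an assignment. -/
def eval (M : AStructure L) (v : ∀ s : ASort, ℕ → M.carrier s) :
    ∀ {s : ASort}, ATerm L s → M.carrier s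
  | _, .var s n => v s n
  | _, .fn f ts => Structure.funMap (M := M.Index) f fun i => M.eval v (ts i)
  | _, .eps => M.eps
  | _, .bot => M.bot
  | _, .rd a i => M.rd (M.eval v a) (M.eval v i)
  | _, .wr a i e => M.wr (M.eval v a) (M.eval v i) (M.eval v e)
  | _, .diff a b => M.diff (M.eval v a) (M.eval v b)

/-- Truth of a quantifier-free formula under an assignment. -/
def Realize (M : AStructure L) (v : ∀ s : ASort, ℕ → M.carrier s) : AFormula L → Prop
  | .falsum => False
  | .eq t u => M.eval v t = M.eval v u
  | .rel R ts => Structure.RelMap (M := M.Index) R fun i => M.eval v (ts i)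
  | .imp φ ψ => M.Realize v φ → M.Realize v ψ

/-- The order relation on indexes. -/
def le [L.IsOrdered] (M : AStructure L) (i j : M.Index) : Prop :=
  Structure.RelMap (leSymb : L.Relations 2) ![i, j]

/-- The strict order on indexes. -/
def lt [L.IsOrdered] (M : AStructure L) (i j : M.Index) : Prop :=
  M.le i j ∧ i ≠ j

/-- The value of the distinguished constant `0`. -/
def zeroVal (zero : L.Constants) (M : AStructure L) : M.Index :=
  Structure.funMap (M := M.Index) zero ![]

/-- `M` is a model of the array theory with maxdiff `ARD(T)` over the index theory `T`. -/
structure IsModel [L.IsOrdered] (zero : L.Constants) (T : L.Theory) (M : AStructure L) : Prop where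
  index_model : M.Index ⊨ T
  rd_wr_same : ∀ (y : M.Array) (i : M.Index) (e : M.Elem),
    M.le (M.zeroVal zero) i → M.rd (M.wr y i e) i = e
  rd_wr_other : ∀ (y : M.Array) (i j : M.Index) (e : M.Elem),
    i ≠ j → M.rd (M.wr y i e) j = M.rd y j
  rd_diff : ∀ x y : M.Array, x ≠ y → M.rd x (M.diff x y) ≠ M.rd y (M.diff x y)
  rd_gt_diff : ∀ (x y : M.Array) (i : M.Index), M.lt (M.diff x y) i → M.rd x i = M.rd y i
  diff_self : ∀ x : M.Array, M.diff x x = M.zeroVal zero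
  rd_neg : ∀ (x : M.Array) (i : M.Index), M.lt i (M.zeroVal zero) → M.rd x i = M.bot
  rd_eps : ∀ i : M.Index, M.rd M.eps i = M.bot

end AStructure

/-- `φ` is `ARD(T)`-satisfiable: true in some model of `ARD(T)` under some assignment. -/
def ARDSat [L.IsOrdered] (zero : L.Constants) (T : L.Theory) (φ : AFormula L) : Prop :=
  ∃ M : AStructure L, M.IsModel zero T ∧ ∃ v : ∀ s : ASort, ℕ → M.carrier s, M.Realize v φ

/-- The satisfiability problem modulo `ARD(T)` for quantifier-free formulas is decidable: the set
of words that denote an `ARD(T)`-satisfiable quantifier-free formula is recursive. -/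
def ARDSMTDecidable [L.IsOrdered] [Primcodable (Σ n, L.Functions n)]
    [Primcodable (Σ n, L.Relations n)] (zero : L.Constants) (T : L.Theory) : Prop :=
  ComputablePred fun w : List (Symbol L) => ∃ φ : AFormula L, φ.word = w ∧ ARDSat zero T φ

end Arrays

end MaxDiff

/-! The proof is a computable many-one reduction of satisfiability modulo ARD(T) to satisfiability
modulo T. Index terms, reads and subformulas of a quantifier-free formula are treated as variables,
named by their own words, and the axioms are instantiated at a finite list of index terms: those of
the formula, the constant 0, and diff(a, b) for all listed array terms a, b. Variables for arrays
are not needed: a = b is equivalent to rd(a, diff(a, b)) = rd(b, diff(a, b)). What remains are index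
atoms and equations between unsorted variables, whose values are elements or truth values.

These finitely many instances suffice. A model of ARD(T) satisfies them (`AStructure.IsModel.laws`).
Conversely, over a model of T take as arrays the functions that are ⊥ below 0 and outside a finite
set. Two such functions differ at finitely many places only, and the order is linear, so there is a
greatest place of difference (`functionModel_isModel`). An array term is interpreted by the function
that takes the values of its read variables at the listed indexes and ⊥ elsewhere. The instances say
exactly that every term and formula then gets the value of its variable (`eval_termAssignment`,
`realize_termAssignment`).

The target problem has a single sort, so the unsorted variables have to be written as index
variables too. Stable infiniteness allows this (`formulaSat_patternsWord_iff`): once the truth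
values of the unsorted equations are fixed, the index part has an infinite model, and the countably
many unsorted values can be injected into it.

For computability, a stack parser reads the word from right to left and records the subexpressions
that it meets. Unique readability ensures that they are determined by the word, and words that are
not formulas are sent to falsity (`reduction_eq`). Everything is primitive recursive except the
lookup of arities, which is computable (`computable_reduction`). -/

namespace MaxDiff

open FirstOrder FirstOrder.Language

/-! ## Unique readability -/

section Readability

variable {L : FirstOrder.Language.{0, 0}}

/-- Concatenations of words from a prefix-free set can be split in only one way. -/
theorem flatMap_append_inj {ι γ : Type*} (l : List ι) (f g : ι → List γ)
    (h : ∀ i ∈ l, ∀ r r', f i ++ r = g i ++ r' → f i = g i ∧ r = r') (r r' : List γ)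
    (e : l.flatMap f ++ r = l.flatMap g ++ r') : (∀ i ∈ l, f i = g i) ∧ r = r' := by
  induction l with
  | nil => simpa using e
  | cons i l ih =>
    simp only [List.flatMap_cons, List.append_assoc] at e
    obtain ⟨h1, h2⟩ := h i (by simp) _ _ e
    obtain ⟨h3, h4⟩ := ih (fun j hj => h j (by simp [hj])) h2
    exact ⟨by simpa [h1] using h3, h4⟩

/-- The head symbol fixes the arity, so the same number of arguments is split off on both sides. The
remainders `r` and `r'` let the induction pass from one argument to the next. -/
theorem termWord_append_inj {n : ℕ} (t t' : L.Term (ℕ ⊕ Fin n)) (r r' : List (Symbol L))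
    (e : termWord t ++ r = termWord t' ++ r') : t = t' ∧ r = r' := by
  induction t generalizing t' r r' with
  | var x =>
    rcases x with x | x <;> rcases t' with (y | y) | ⟨f, ts⟩ <;> simp_all [termWord, Fin.ext_iff]
  | func f ts ih =>
    rcases t' with (y | y) | ⟨f', ts'⟩
    · simp [termWord] at e
    · simp [termWord] at e
    · simp only [termWord, List.cons_append, List.cons.injEq, Symbol.fn.injEq] at e
      obtain ⟨e1, e2⟩ := e
      cases e1
      obtain ⟨h1, h2⟩ := flatMap_append_inj _ _ _ (fun i _ r r' e => by
        obtain ⟨h1, h2⟩ := ih i _ _ _ e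
        exact ⟨by rw [h1], h2⟩) _ _ e2
      refine ⟨?_, h2⟩
      congr 1
      funext i
      exact (ih i (ts' i) [] [] (by rw [h1 i (by simp)])).1

theorem formulaWord_append_inj {n : ℕ} (φ φ' : L.BoundedFormula ℕ n) (r r' : List (Symbol L))
    (e : formulaWord φ ++ r = formulaWord φ' ++ r') : φ = φ' ∧ r = r' := by
  induction φ generalizing r r' with
  | falsum => cases φ' <;> simp_all [formulaWord]
  | equal t u =>
    cases φ' with
    | equal t' u' =>
      simp only [formulaWord, List.cons_append, List.append_assoc, List.cons.injEq, true_and] at e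
      obtain ⟨rfl, g1⟩ := termWord_append_inj _ _ _ _ e
      obtain ⟨rfl, g2⟩ := termWord_append_inj _ _ _ _ g1
      exact ⟨rfl, g2⟩
    | _ => simp [formulaWord] at e
  | rel R ts =>
    cases φ' with
    | rel R' ts' =>
      simp only [formulaWord, List.cons_append, List.cons.injEq, Symbol.rel.injEq] at e
      obtain ⟨e1, e2⟩ := e
      cases e1
      obtain ⟨h1, h2⟩ := flatMap_append_inj _ _ _ (fun i _ r r' e => by
        obtain ⟨h1, h2⟩ := termWord_append_inj _ _ _ _ e
        exact ⟨by rw [h1], h2⟩) _ _ e2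
      refine ⟨?_, h2⟩
      congr 1
      funext i
      exact (termWord_append_inj (ts i) (ts' i) [] [] (by rw [h1 i (by simp)])).1
    | _ => simp [formulaWord] at e
  | imp φ ψ ih1 ih2 =>
    cases φ' with
    | imp φ' ψ' =>
      simp only [formulaWord, List.cons_append, List.append_assoc, List.cons.injEq, true_and] at e
      obtain ⟨rfl, g1⟩ := ih1 _ _ _ e
      obtain ⟨rfl, g2⟩ := ih2 _ _ _ g1
      exact ⟨rfl, g2⟩
    | _ => simp [formulaWord] at e
  | all φ ih =>
    cases φ' with
    | all φ' =>
      simp only [formulaWord, List.cons_append, List.cons.injEq, true_and] at e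
      obtain ⟨rfl, g1⟩ := ih _ _ _ e
      exact ⟨rfl, g1⟩
    | _ => simp [formulaWord] at e

/-- The decision problems ask for some formula with a given word; by injectivity it is the formula
that was written down. -/
theorem formulaWord_injective {n : ℕ} :
    Function.Injective (formulaWord : L.BoundedFormula ℕ n → List (Symbol L)) := fun φ φ' e =>
  (formulaWord_append_inj φ φ' [] [] (by rw [e])).1

/-- The sorts are not assumed to agree: the head symbol determines the sort, hence the equation in
the sigma type. -/
theorem ATerm.word_append_inj {s s' : ASort} (t : ATerm L s) (t' : ATerm L s')
    (r r' : List (Symbol L)) (e : t.word ++ r = t'.word ++ r') :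
    (⟨s, t⟩ : Σ s, ATerm L s) = ⟨s', t'⟩ ∧ r = r' := by
  induction t generalizing s' r r' with
  | var s n =>
    cases t' with
    | var s' n' => cases s <;> cases s' <;> simp_all [ATerm.word, varSymbol]
    | _ => cases s <;> simp [ATerm.word, varSymbol] at e
  | fn f ts ih =>
    cases t' with
    | var s' n' => cases s' <;> simp [ATerm.word, varSymbol] at e
    | fn f' ts' =>
      simp only [ATerm.word, List.cons_append, List.cons.injEq, Symbol.fn.injEq] at e
      obtain ⟨e1, e2⟩ := e
      cases e1
      obtain ⟨h1, h2⟩ := flatMap_append_inj _ _ _ (fun i _ r r' e => by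
        obtain ⟨h1, h2⟩ := ih i _ _ _ e
        simp only [Sigma.mk.injEq, heq_eq_eq, true_and] at h1
        exact ⟨by rw [h1], h2⟩) _ _ e2
      refine ⟨?_, h2⟩
      congr 2
      funext i
      have := (ih i (ts' i) [] [] (by rw [h1 i (by simp)])).1
      simpa using this
    | _ => simp [ATerm.word] at e
  | eps =>
    cases t' with
    | var s' n' => cases s' <;> simp [ATerm.word, varSymbol] at e
    | _ => simp_all [ATerm.word]
  | bot =>
    cases t' with
    | var s' n' => cases s' <;> simp [ATerm.word, varSymbol] at e
    | _ => simp_all [ATerm.word]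
  | rd a i iha ihi =>
    cases t' with
    | var s' n' => cases s' <;> simp [ATerm.word, varSymbol] at e
    | rd a' i' =>
      simp only [ATerm.word, List.cons_append, List.append_assoc, List.cons.injEq, true_and] at e
      obtain ⟨h1, g1⟩ := iha _ _ _ e
      cases h1
      obtain ⟨h1, g2⟩ := ihi _ _ _ g1
      cases h1
      exact ⟨rfl, g2⟩
    | _ => simp [ATerm.word] at e
  | diff a i iha ihi =>
    cases t' with
    | var s' n' => cases s' <;> simp [ATerm.word, varSymbol] at e
    | diff a' i' =>
      simp only [ATerm.word, List.cons_append, List.append_assoc, List.cons.injEq, true_and] at e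
      obtain ⟨h1, g1⟩ := iha _ _ _ e
      cases h1
      obtain ⟨h1, g2⟩ := ihi _ _ _ g1
      cases h1
      exact ⟨rfl, g2⟩
    | _ => simp [ATerm.word] at e
  | wr a i x iha ihi ihx =>
    cases t' with
    | var s' n' => cases s' <;> simp [ATerm.word, varSymbol] at e
    | wr a' i' x' =>
      simp only [ATerm.word, List.cons_append, List.append_assoc, List.cons.injEq, true_and] at e
      obtain ⟨h1, g1⟩ := iha _ _ _ e
      cases h1
      obtain ⟨h1, g2⟩ := ihi _ _ _ g1
      cases h1
      obtain ⟨h1, g3⟩ := ihx _ _ _ g2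
      cases h1
      exact ⟨rfl, g3⟩
    | _ => simp [ATerm.word] at e

theorem ATerm.word_ne_formula {s : ASort} (t : ATerm L s) (φ : AFormula L)
    (r r' : List (Symbol L)) : t.word ++ r ≠ φ.word ++ r' := by
  cases t with
  | var s n => cases s <;> cases φ <;> simp [ATerm.word, AFormula.word, varSymbol]
  | _ => cases φ <;> simp [ATerm.word, AFormula.word]

theorem AFormula.word_append_inj (φ φ' : AFormula L) (r r' : List (Symbol L))
    (e : φ.word ++ r = φ'.word ++ r') : φ = φ' ∧ r = r' := by
  induction φ generalizing φ' r r' with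
  | falsum => cases φ' <;> simp_all [AFormula.word]
  | eq t u =>
    cases φ' with
    | eq t' u' =>
      simp only [AFormula.word, List.cons_append, List.append_assoc, List.cons.injEq,
        true_and] at e
      obtain ⟨h1, g1⟩ := ATerm.word_append_inj _ _ _ _ e
      cases h1
      obtain ⟨h1, g2⟩ := ATerm.word_append_inj _ _ _ _ g1
      cases h1
      exact ⟨rfl, g2⟩
    | _ => simp [AFormula.word] at e
  | rel R ts =>
    cases φ' with
    | rel R' ts' =>
      simp only [AFormula.word, List.cons_append, List.cons.injEq, Symbol.rel.injEq] at e
      obtain ⟨e1, e2⟩ := e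
      cases e1
      obtain ⟨h1, h2⟩ := flatMap_append_inj _ _ _ (fun i _ r r' e => by
        obtain ⟨h1, h2⟩ := ATerm.word_append_inj _ _ _ _ e
        simp only [Sigma.mk.injEq, heq_eq_eq, true_and] at h1
        exact ⟨by rw [h1], h2⟩) _ _ e2
      refine ⟨?_, h2⟩
      congr 1
      funext i
      have := (ATerm.word_append_inj (ts i) (ts' i) [] [] (by rw [h1 i (by simp)])).1
      simpa using this
    | _ => simp [AFormula.word] at e
  | imp φ ψ ih1 ih2 =>
    cases φ' with
    | imp φ' ψ' =>
      simp only [AFormula.word, List.cons_append, List.append_assoc, List.cons.injEq,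
        true_and] at e
      obtain ⟨rfl, g1⟩ := ih1 _ _ _ e
      obtain ⟨rfl, g2⟩ := ih2 _ _ _ g1
      exact ⟨rfl, g2⟩
    | _ => simp [AFormula.word] at e

theorem ATerm.word_injective {s : ASort} :
    Function.Injective (ATerm.word : ATerm L s → List (Symbol L)) := fun t t' e => by
  have := (ATerm.word_append_inj t t' [] [] (by rw [e])).1
  cases this
  rfl

theorem ATerm.sort_eq_of_word_eq {s s' : ASort} {t : ATerm L s} {t' : ATerm L s'}
    (e : t.word = t'.word) : s = s' :=
  congrArg Sigma.fst (ATerm.word_append_inj t t' [] [] (by rw [e])).1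

theorem AFormula.word_injective :
    Function.Injective (AFormula.word : AFormula L → List (Symbol L)) := fun φ φ' e =>
  (AFormula.word_append_inj φ φ' [] [] (by rw [e])).1

/-- `IsWord k u` says that `u` is the word of a term of sort `s`, if `k = some s`, and of a
formula, if `k = none`. -/
def IsWord : Option ASort → List (Symbol L) → Prop
  | some s, u => ∃ t : ATerm L s, t.word = u
  | none, u => ∃ φ : AFormula L, φ.word = u

/-- This leaves the empty word free to name the variable that stands for truth. -/
theorem IsWord.ne_nil {k : Option ASort} {u : List (Symbol L)} (h : IsWord k u) : u ≠ [] := by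
  rcases k with _ | s <;> obtain ⟨t, rfl⟩ := h <;> cases t <;> simp [ATerm.word, AFormula.word]

end Readability

/-! ## A nondeterministic stack parser -/

/-- The sorts are coded by the numbers below three. -/
def ASort.equivFin : ASort ≃ Fin 3 where
  toFun
    | .array => 0
    | .elem => 1
    | .index => 2
  invFun
    | 0 => .array
    | 1 => .elem
    | 2 => .index
  left_inv s := by cases s <;> rfl
  right_inv k := by fin_cases k <;> rfl

instance : DecidableEq ASort := ASort.equivFin.decidableEq

instance : Primcodable ASort := Primcodable.ofEquiv _ ASort.equivFin

section Parser

variable {L : FirstOrder.Language.{0, 0}}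

/-- A word together with the kind of expression that it denotes: `some s` for terms of sort `s` and
`none` for formulas. -/
abbrev Item (L : FirstOrder.Language.{0, 0}) : Type := Option ASort × List (Symbol L)

/-- The kind of an expression, its head symbol, and its immediate subexpressions. -/
abbrev Node (L : FirstOrder.Language.{0, 0}) : Type := Option ASort × Symbol L × List (Item L)

/-- The word of the expression that a node describes. -/
def nodeWord (m : Node L) : List (Symbol L) := m.2.1 :: m.2.2.flatMap Prod.snd

/-- The node of a term. -/
def ATerm.node {s : ASort} : ATerm L s → Node L
  | .var s n => (some s, varSymbol s n, [])
  | .fn f ts => (some .index, .fn ⟨_, f⟩, (List.finRange _).map fun i => (some .index, (ts i).word))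
  | .eps => (some .array, .eps, [])
  | .bot => (some .elem, .bot, [])
  | .rd a i => (some .elem, .rd, [(some .array, a.word), (some .index, i.word)])
  | .wr a i e => (some .array, .wr,
      [(some .array, a.word), (some .index, i.word), (some .elem, e.word)])
  | .diff a b => (some .index, .diff, [(some .array, a.word), (some .array, b.word)])

/-- The node of a formula. -/
def AFormula.node : AFormula L → Node L
  | .falsum => (none, .falsum, [])
  | .eq (s := s) t u => (none, .eq, [(some s, t.word), (some s, u.word)])
  | .rel R ts => (none, .rel ⟨_, R⟩, (List.finRange _).map fun i => (some .index, (ts i).word))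
  | .imp φ ψ => (none, .imp, [(none, φ.word), (none, ψ.word)])

theorem ATerm.node_fst {s : ASort} (t : ATerm L s) : t.node.1 = some s := by cases t <;> rfl

theorem ATerm.nodeWord_node {s : ASort} (t : ATerm L s) : nodeWord t.node = t.word := by
  cases t <;> simp [nodeWord, ATerm.node, ATerm.word, List.flatMap_map]

theorem AFormula.node_fst (φ : AFormula L) : φ.node.1 = none := by cases φ <;> rfl

theorem AFormula.nodeWord_node (φ : AFormula L) : nodeWord φ.node = φ.word := by
  cases φ <;> simp [nodeWord, AFormula.node, AFormula.word, List.flatMap_map]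

/-- `m` is the node of a term or of a formula. -/
def IsNode (m : Node L) : Prop :=
  (∃ s, ∃ t : ATerm L s, m = t.node) ∨ ∃ φ : AFormula L, m = φ.node

theorem IsNode.isWord {m : Node L} (h : IsNode m) : IsWord m.1 (nodeWord m) := by
  rcases h with ⟨s, t, rfl⟩ | ⟨φ, rfl⟩
  · rw [t.node_fst, t.nodeWord_node]
    exact ⟨t, rfl⟩
  · rw [φ.node_fst, φ.nodeWord_node]
    exact ⟨φ, rfl⟩

/-- By unique readability the word of a node determines the node; this turns facts about recorded
words into facts about recorded nodes. -/
theorem IsNode.eq_term_node {m : Node L} (h : IsNode m) {s : ASort} {t : ATerm L s}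
    (e : nodeWord m = t.word) : m = t.node := by
  rcases h with ⟨s, t', rfl⟩ | ⟨φ, rfl⟩
  · rw [t'.nodeWord_node] at e
    cases ATerm.sort_eq_of_word_eq e
    rw [ATerm.word_injective e]
  · rw [φ.nodeWord_node] at e
    exact absurd (congrArg (· ++ []) e.symm) (ATerm.word_ne_formula _ _ _ _)

theorem IsNode.eq_formula_node {m : Node L} (h : IsNode m) {φ : AFormula L}
    (e : nodeWord m = φ.word) : m = φ.node := by
  rcases h with ⟨s, t', rfl⟩ | ⟨φ, rfl⟩
  · rw [t'.nodeWord_node] at e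
    exact absurd (congrArg (· ++ []) e) (ATerm.word_ne_formula _ _ _ _)
  · rw [φ.nodeWord_node] at e
    rw [AFormula.word_injective e]

/-- The possible kinds of the arguments of a symbol, with the resulting kind. -/
def signatures : Symbol L → List (List (Option ASort) × Option ASort)
  | .arrayVar _ => [([], some .array)]
  | .elemVar _ => [([], some .elem)]
  | .indexVar _ => [([], some .index)]
  | .boundVar _ => []
  | .fn f => [(List.replicate f.1 (some .index), some .index)]
  | .rel R => [(List.replicate R.1 (some .index), none)]
  | .eps => [([], some .array)]
  | .bot => [([], some .elem)]
  | .rd => [([some .array, some .index], some .elem)]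
  | .wr => [([some .array, some .index, some .elem], some .array)]
  | .diff => [([some .array, some .array], some .index)]
  | .falsum => [([], none)]
  | .eq => [.array, .elem, .index].map fun s => ([some s, some s], none)
  | .imp => [([none, none], none)]
  | .all => []

theorem exists_terms_of_isWord {s : ASort} {n : ℕ} {l : List (Item L)}
    (hk : l.map Prod.fst = List.replicate n (some s)) (hl : ∀ x ∈ l, IsWord x.1 x.2) :
    ∃ ts : Fin n → ATerm L s, l = (List.finRange n).map fun i => (some s, (ts i).word) := by
  have hn : l.length = n := by simpa using congrArg List.length hk
  have hs : ∀ (i : ℕ) (h : i < l.length), (l[i]).1 = some s := fun i h => by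
    have : (l.map Prod.fst)[i]? = (List.replicate n (some s))[i]? := by rw [hk]
    rw [hn] at h
    simpa [h, hn, List.getElem?_eq_getElem] using this
  have : ∀ i : Fin n, ∃ t : ATerm L s, t.word = (l[i.1]'(by omega)).2 := fun i => by
    have h := hl _ (l.getElem_mem (n := i.1) (by omega))
    rw [hs] at h
    exact h
  choose ts hts using this
  refine ⟨ts, List.ext_getElem (by simp [hn]) fun i h1 h2 => ?_⟩
  simp [hts, ← hs i h1]

/-- Each entry of the signature table belongs to a constructor of terms or formulas, and symbols
used only with quantifiers have no entry. This is the soundness of a single parser step. -/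
theorem isNode_of_signature {s : Symbol L} {l : List (Item L)} {k : Option ASort}
    (hs : (l.map Prod.fst, k) ∈ signatures s) (hl : ∀ x ∈ l, IsWord x.1 x.2) :
    IsNode (k, s, l) := by
  cases s with
  | arrayVar n =>
    simp only [signatures, List.mem_singleton, Prod.mk.injEq, List.map_eq_nil_iff] at hs
    obtain ⟨rfl, rfl⟩ := hs
    exact .inl ⟨_, .var .array n, rfl⟩
  | elemVar n =>
    simp only [signatures, List.mem_singleton, Prod.mk.injEq, List.map_eq_nil_iff] at hs
    obtain ⟨rfl, rfl⟩ := hs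
    exact .inl ⟨_, .var .elem n, rfl⟩
  | indexVar n =>
    simp only [signatures, List.mem_singleton, Prod.mk.injEq, List.map_eq_nil_iff] at hs
    obtain ⟨rfl, rfl⟩ := hs
    exact .inl ⟨_, .var .index n, rfl⟩
  | boundVar n => simp [signatures] at hs
  | all => simp [signatures] at hs
  | fn f =>
    simp only [signatures, List.mem_singleton, Prod.mk.injEq] at hs
    obtain ⟨hs, rfl⟩ := hs
    obtain ⟨ts, rfl⟩ := exists_terms_of_isWord hs hl
    exact .inl ⟨_, .fn f.2 ts, rfl⟩
  | rel R =>
    simp only [signatures, List.mem_singleton, Prod.mk.injEq] at hs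
    obtain ⟨hs, rfl⟩ := hs
    obtain ⟨ts, rfl⟩ := exists_terms_of_isWord hs hl
    exact .inr ⟨.rel R.2 ts, rfl⟩
  | eps =>
    simp only [signatures, List.mem_singleton, Prod.mk.injEq, List.map_eq_nil_iff] at hs
    obtain ⟨rfl, rfl⟩ := hs
    exact .inl ⟨_, .eps, rfl⟩
  | bot =>
    simp only [signatures, List.mem_singleton, Prod.mk.injEq, List.map_eq_nil_iff] at hs
    obtain ⟨rfl, rfl⟩ := hs
    exact .inl ⟨_, .bot, rfl⟩
  | falsum =>
    simp only [signatures, List.mem_singleton, Prod.mk.injEq, List.map_eq_nil_iff] at hs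
    obtain ⟨rfl, rfl⟩ := hs
    exact .inr ⟨.falsum, rfl⟩
  | rd =>
    simp only [signatures, List.mem_singleton, Prod.mk.injEq, List.map_eq_cons_iff,
      List.map_eq_nil_iff] at hs
    obtain ⟨⟨⟨k1, u1⟩, l, rfl, rfl, ⟨k2, u2⟩, l, rfl, rfl, rfl⟩, rfl⟩ := hs
    simp only [List.forall_mem_cons] at hl
    obtain ⟨⟨a, rfl⟩, ⟨i, rfl⟩, -⟩ := hl
    exact .inl ⟨_, .rd a i, rfl⟩
  | diff =>
    simp only [signatures, List.mem_singleton, Prod.mk.injEq, List.map_eq_cons_iff,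
      List.map_eq_nil_iff] at hs
    obtain ⟨⟨⟨k1, u1⟩, l, rfl, rfl, ⟨k2, u2⟩, l, rfl, rfl, rfl⟩, rfl⟩ := hs
    simp only [List.forall_mem_cons] at hl
    obtain ⟨⟨a, rfl⟩, ⟨i, rfl⟩, -⟩ := hl
    exact .inl ⟨_, .diff a i, rfl⟩
  | imp =>
    simp only [signatures, List.mem_singleton, Prod.mk.injEq, List.map_eq_cons_iff,
      List.map_eq_nil_iff] at hs
    obtain ⟨⟨⟨k1, u1⟩, l, rfl, rfl, ⟨k2, u2⟩, l, rfl, rfl, rfl⟩, rfl⟩ := hs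
    simp only [List.forall_mem_cons] at hl
    obtain ⟨⟨a, rfl⟩, ⟨i, rfl⟩, -⟩ := hl
    exact .inr ⟨.imp a i, rfl⟩
  | wr =>
    simp only [signatures, List.mem_singleton, Prod.mk.injEq, List.map_eq_cons_iff,
      List.map_eq_nil_iff] at hs
    obtain ⟨⟨⟨k1, u1⟩, l, rfl, rfl, ⟨k2, u2⟩, l, rfl, rfl, ⟨k3, u3⟩, l, rfl, rfl, rfl⟩, rfl⟩ := hs
    simp only [List.forall_mem_cons] at hl
    obtain ⟨⟨a, rfl⟩, ⟨i, rfl⟩, ⟨e, rfl⟩, -⟩ := hl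
    exact .inl ⟨_, .wr a i e, rfl⟩
  | eq =>
    simp only [signatures, List.mem_map, Prod.mk.injEq, @eq_comm _ _ (l.map _),
      List.map_eq_cons_iff, List.map_eq_nil_iff] at hs
    obtain ⟨s, -, ⟨⟨k1, u1⟩, l, rfl, rfl, ⟨k2, u2⟩, l, rfl, rfl, rfl⟩, rfl⟩ := hs
    simp only [List.forall_mem_cons] at hl
    obtain ⟨⟨t, rfl⟩, ⟨u, rfl⟩, -⟩ := hl
    exact .inr ⟨.eq t u, rfl⟩

/-- A stack of parsed expressions, with the nodes met so far. -/
abbrev ParserState (L : FirstOrder.Language.{0, 0}) : Type := List (Item L) × List (Node L)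

/-- Apply the symbol `s`, with signature `g`, to the top of the stack. -/
def push (s : Symbol L) (S : ParserState L) (g : List (Option ASort) × Option ASort) :
    List (ParserState L) :=
  if (S.1.take g.1.length).map Prod.fst = g.1 then
    [((g.2, s :: (S.1.take g.1.length).flatMap Prod.snd) :: S.1.drop g.1.length,
      (g.2, s, S.1.take g.1.length) :: S.2)]
  else []

/-- Read a symbol for which a list of signatures is given. -/
def step (x : Symbol L × List (List (Option ASort) × Option ASort)) (Q : List (ParserState L)) :
    List (ParserState L) :=
  Q.flatMap fun S => x.2.flatMap fun g => push x.1 S g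

/-- Read a word from the right to the left, starting from the nodes `m₀`. -/
def run (m₀ : List (Node L)) (w : List (Symbol L)) : List (ParserState L) :=
  (w.map fun s => (s, signatures s)).foldr step [([], m₀)]

theorem mem_run_cons {m₀ : List (Node L)} {s : Symbol L} {w : List (Symbol L)}
    {S : ParserState L} : S ∈ run m₀ (s :: w) ↔
      ∃ S' ∈ run m₀ w, ∃ g ∈ signatures s, S ∈ push s S' g := by
  simp [run, step]

/-- Every node in `m` belongs to an expression, whose immediate subexpressions have nodes
in `m`. -/
def NodesClosed (m : List (Node L)) : Prop :=
  ∀ n ∈ m, IsNode n ∧ ∀ x ∈ n.2.2, ∃ n' ∈ m, (n'.1, nodeWord n') = x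

/-- Reading from the right, the arguments of a symbol lie on top of the stack, in order, when the
symbol is met. Popping them keeps the concatenation of the stack equal to the part already read, and
the new node has its arguments among the nodes recorded before. -/
theorem run_sound {m₀ : List (Node L)} (h₀ : NodesClosed m₀) {w : List (Symbol L)}
    {S : ParserState L} (hS : S ∈ run m₀ w) :
    S.1.flatMap Prod.snd = w ∧ (∀ x ∈ S.1, ∃ n ∈ S.2, (n.1, nodeWord n) = x) ∧
      NodesClosed S.2 ∧ m₀ ⊆ S.2 := by
  induction w generalizing S with
  | nil =>
    simp only [run, List.map_nil, List.foldr_nil, List.mem_singleton] at hS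
    subst hS
    exact ⟨rfl, by simp, h₀, by simp⟩
  | cons s w ih =>
    obtain ⟨⟨st, nd⟩, hS', ⟨ks, k⟩, hg, h⟩ := mem_run_cons.1 hS
    obtain ⟨h1, h2, h3, h4⟩ := ih hS'
    simp only [push] at h
    split_ifs at h with hks
    · simp only [List.mem_singleton] at h
      subst h
      have hw : ∀ x ∈ st.take ks.length, IsWord x.1 x.2 := fun x hx => by
        obtain ⟨n, hn, rfl⟩ := h2 x (List.mem_of_mem_take hx)
        exact (h3 n hn).1.isWord
      have hn : IsNode (k, s, st.take ks.length) := isNode_of_signature (by rwa [hks]) hw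
      refine ⟨?_, ?_, ?_, ?_⟩
      · simp only [List.flatMap_cons, List.cons_append, ← h1]
        rw [← List.flatMap_append, List.take_append_drop]
      · simp only [List.forall_mem_cons]
        refine ⟨⟨_, List.mem_cons_self, rfl⟩, fun x hx => ?_⟩
        obtain ⟨n, hn, e⟩ := h2 x (List.mem_of_mem_drop hx)
        exact ⟨n, List.mem_cons_of_mem _ hn, e⟩
      · unfold NodesClosed
        simp only [List.forall_mem_cons]
        refine ⟨⟨hn, fun x hx => ?_⟩, fun n' hn' => ⟨(h3 n' hn').1, fun x hx => ?_⟩⟩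
        · obtain ⟨n, hn, e⟩ := h2 x (List.mem_of_mem_take hx)
          exact ⟨n, List.mem_cons_of_mem _ hn, e⟩
        · obtain ⟨n, hn, e⟩ := (h3 n' hn').2 x hx
          exact ⟨n, List.mem_cons_of_mem _ hn, e⟩
      · exact fun x hx => List.mem_cons_of_mem _ (h4 hx)
    · simp at h

/-- Since all signatures are tried, the intended one is among them. The recorded nodes stay
existential here, because `run_sound` controls them for every run. -/
theorem run_cons_complete {m₀ : List (Node L)} {s : Symbol L} {w : List (Symbol L)}
    {l st : List (Item L)} {k : Option ASort} (hs : (l.map Prod.fst, k) ∈ signatures s)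
    (h : ∃ m, (l ++ st, m) ∈ run m₀ w) :
    ∃ m, ((k, s :: l.flatMap Prod.snd) :: st, m) ∈ run m₀ (s :: w) := by
  obtain ⟨m, h⟩ := h
  exact ⟨_, mem_run_cons.2 ⟨_, h, _, hs, by simp [push]; rfl⟩⟩

theorem run_flatMap_complete {ι : Type*} {m₀ : List (Node L)} {f : ι → List (Symbol L)}
    {k : Option ASort} (hf : ∀ i w st, (∃ m, (st, m) ∈ run m₀ w) →
      ∃ m, ((k, f i) :: st, m) ∈ run m₀ (f i ++ w)) (l : List ι) {w : List (Symbol L)}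
    {st : List (Item L)} (h : ∃ m, (st, m) ∈ run m₀ w) :
    ∃ m, (l.map (fun i => (k, f i)) ++ st, m) ∈ run m₀ (l.flatMap f ++ w) := by
  induction l with
  | nil => simpa using h
  | cons i l ih => simpa using hf i _ _ ih

/-- The suffix `w` and the stack `st` are arbitrary because, when an argument is parsed, the
arguments to its right are already on the stack. -/
theorem ATerm.run_complete {m₀ : List (Node L)} {s : ASort} (t : ATerm L s) (w : List (Symbol L))
    (st : List (Item L)) (h : ∃ m, (st, m) ∈ run m₀ w) :
    ∃ m, ((some s, t.word) :: st, m) ∈ run m₀ (t.word ++ w) := by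
  induction t generalizing w st with
  | var s n =>
    cases s <;> exact run_cons_complete (l := []) (by simp [signatures, varSymbol]) h
  | fn f ts ih =>
    have := run_cons_complete (s := .fn ⟨_, f⟩) (k := some .index) (by
      simp [signatures, Function.comp_def]) (run_flatMap_complete ih (List.finRange _) h)
    simpa [List.flatMap_map, ATerm.word] using this
  | eps => exact run_cons_complete (l := []) (by simp [signatures]) h
  | bot => exact run_cons_complete (l := []) (by simp [signatures]) h
  | rd a i iha ihi =>
    have := run_cons_complete (s := .rd) (k := some .elem) (l := [_, _]) (by simp [signatures])
      (iha _ _ (ihi _ _ h))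
    simpa [ATerm.word] using this
  | diff a i iha ihi =>
    have := run_cons_complete (s := .diff) (k := some .index) (l := [_, _]) (by simp [signatures])
      (iha _ _ (ihi _ _ h))
    simpa [ATerm.word] using this
  | wr a i e iha ihi ihe =>
    have := run_cons_complete (s := .wr) (k := some .array) (l := [_, _, _]) (by simp [signatures])
      (iha _ _ (ihi _ _ (ihe _ _ h)))
    simpa [ATerm.word] using this

theorem AFormula.run_complete {m₀ : List (Node L)} (φ : AFormula L) (w : List (Symbol L))
    (st : List (Item L)) (h : ∃ m, (st, m) ∈ run m₀ w) :
    ∃ m, ((none, φ.word) :: st, m) ∈ run m₀ (φ.word ++ w) := by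
  induction φ generalizing w st with
  | falsum => exact run_cons_complete (l := []) (by simp [signatures]) h
  | @eq s t u =>
    have := run_cons_complete (s := .eq) (k := none) (l := [_, _])
      (by cases s <;> simp [signatures]) (t.run_complete _ _ (u.run_complete _ _ h))
    simpa [AFormula.word] using this
  | rel R ts =>
    have := run_cons_complete (s := .rel ⟨_, R⟩) (k := none) (by
      simp [signatures, Function.comp_def])
      (run_flatMap_complete (fun i => (ts i).run_complete) (List.finRange _) h)
    simpa [List.flatMap_map, AFormula.word] using this
  | imp φ ψ ih1 ih2 =>
    have := run_cons_complete (s := .imp) (k := none) (l := [_, _]) (by simp [signatures])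
      (ih1 _ _ (ih2 _ _ h))
    simpa [AFormula.word] using this

end Parser

/-! ## Closure properties of primitive recursive functions -/

section Primrec

attribute [fun_prop] Primrec

variable {α β γ σ : Type*} [Primcodable α] [Primcodable β] [Primcodable γ] [Primcodable σ]

-- With these closure rules `fun_prop` proves primitive recursiveness by following the syntax of a
-- definition.
@[fun_prop]
theorem primrec_id : Primrec fun a : α => a := Primrec.id

@[fun_prop]
theorem primrec_const (c : β) : Primrec fun _ : α => c := Primrec.const c

@[fun_prop]
theorem primrec_comp {f : β → γ} {g : α → β} (hf : Primrec f) (hg : Primrec g) :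
    Primrec fun a => f (g a) := hf.comp hg

@[fun_prop]
theorem primrec_fst {f : α → β × γ} (hf : Primrec f) : Primrec fun a => (f a).1 :=
  Primrec.fst.comp hf

@[fun_prop]
theorem primrec_snd {f : α → β × γ} (hf : Primrec f) : Primrec fun a => (f a).2 :=
  Primrec.snd.comp hf

@[fun_prop]
theorem primrec_mk {f : α → β} {g : α → γ} (hf : Primrec f) (hg : Primrec g) :
    Primrec fun a => (f a, g a) := hf.pair hg

@[fun_prop]
theorem primrec_inl {f : α → β} (hf : Primrec f) :
    Primrec fun a => (Sum.inl (f a) : β ⊕ γ) := Primrec.sumInl.comp hf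

@[fun_prop]
theorem primrec_inr {f : α → γ} (hf : Primrec f) :
    Primrec fun a => (Sum.inr (f a) : β ⊕ γ) := Primrec.sumInr.comp hf

@[fun_prop]
theorem primrec_sum_elim {f : α → β ⊕ γ} {g : α → β → σ} {h : α → γ → σ} (hf : Primrec f)
    (hg : Primrec fun p : α × β => g p.1 p.2) (hh : Primrec fun p : α × γ => h p.1 p.2) :
    Primrec fun a => Sum.elim (g a) (h a) (f a) :=
  (Primrec.sumCasesOn hf (Primrec.to₂ hg) (Primrec.to₂ hh)).of_eq fun a => by
    cases f a <;> rfl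

@[fun_prop]
theorem primrec_cons {f : α → β} {g : α → List β} (hf : Primrec f) (hg : Primrec g) :
    Primrec fun a => f a :: g a := Primrec.list_cons.comp hf hg

@[fun_prop]
theorem primrec_append {f g : α → List β} (hf : Primrec f) (hg : Primrec g) :
    Primrec fun a => f a ++ g a := Primrec.list_append.comp hf hg

@[fun_prop]
theorem primrec_take {f : α → ℕ} {g : α → List β} (hf : Primrec f) (hg : Primrec g) :
    Primrec fun a => (g a).take (f a) := Primrec.list_take.comp hf hg

@[fun_prop]
theorem primrec_drop {f : α → ℕ} {g : α → List β} (hf : Primrec f) (hg : Primrec g) :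
    Primrec fun a => (g a).drop (f a) := Primrec.list_drop.comp hf hg

@[fun_prop]
theorem primrec_length {f : α → List β} (hf : Primrec f) : Primrec fun a => (f a).length :=
  Primrec.list_length.comp hf

@[fun_prop]
theorem primrec_getD {f : α → List β} (n : ℕ) (d : β) (hf : Primrec f) :
    Primrec fun a => (f a).getD n d := (Primrec.list_getD d).comp hf (Primrec.const n)

@[fun_prop]
theorem primrec_flatMap {f : α → List β} {g : α → β → List γ} (hf : Primrec f)
    (hg : Primrec fun p : α × β => g p.1 p.2) : Primrec fun a => (f a).flatMap (g a) :=
  Primrec.list_flatMap hf hg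

@[fun_prop]
theorem primrec_map {f : α → List β} {g : α → β → γ} (hf : Primrec f)
    (hg : Primrec fun p : α × β => g p.1 p.2) : Primrec fun a => (f a).map (g a) :=
  Primrec.list_map hf hg

@[fun_prop]
theorem primrec_foldr {f : α → List β} {g : α → σ} {h : α → β → σ → σ} (hf : Primrec f)
    (hg : Primrec g) (hh : Primrec fun p : α × β × σ => h p.1 p.2.1 p.2.2) :
    Primrec fun a => (f a).foldr (h a) (g a) :=
  Primrec.list_foldr hf hg (h := fun a p => h a p.1 p.2) hh

@[fun_prop]
theorem primrec_ite_eq [DecidableEq β] {f g : α → β} {h k : α → σ} (hf : Primrec f)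
    (hg : Primrec g) (hh : Primrec h) (hk : Primrec k) :
    Primrec fun a => if f a = g a then h a else k a :=
  Primrec.ite (Primrec.eq.comp hf hg) hh hk

@[fun_prop]
theorem primrec_cond {f : α → Bool} {g h : α → σ} (hf : Primrec f) (hg : Primrec g)
    (hh : Primrec h) : Primrec fun a => bif f a then g a else h a := Primrec.cond hf hg hh

/-- Mapping a computable function over a list is computable. -/
theorem computable_map {f : α → β} (hf : Computable f) : Computable fun l : List α => l.map f := by
  -- Recursion on the length, appending the image of one entry at each stage. The branch for a
  -- missing entry is never taken, since the recursion stops at the length.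
  have h : Computable fun l : List α => (Nat.rec [] (fun n acc =>
      Option.casesOn (l[n]?) acc fun a => acc.concat (f a)) l.length : List β) := by
    refine Computable.nat_rec Computable.list_length (Computable.const []) (h := fun l p =>
      Option.casesOn (l[p.1]?) p.2 fun a => p.2.concat (f a)) ?_
    refine Computable.option_casesOn (o := fun q : List α × ℕ × List β => q.1[q.2.1]?)
      (f := fun q => q.2.2) (g := fun q a => q.2.2.concat (f a)) ?_ ?_ ?_
    · exact Computable.list_getElem?.comp Computable.fst (Computable.fst.comp Computable.snd)
    · exact Computable.snd.comp Computable.snd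
    · refine (Computable.list_concat.comp
        ((Computable.snd.comp Computable.snd).comp Computable.fst)
        (hf.comp Computable.snd)).of_eq fun p => ?_
      simp
  refine h.of_eq fun l => ?_
  suffices ∀ n ≤ l.length, (Nat.rec [] (fun n acc =>
      Option.casesOn (l[n]?) acc fun a => acc.concat (f a)) n : List β) = (l.take n).map f by
    simpa using this l.length le_rfl
  intro n hn
  induction n with
  | zero => simp
  | succ n ih =>
    rw [List.take_add_one, List.map_append, ← ih (by omega)]
    simp [List.getElem?_eq_getElem (show n < l.length by omega)]

end Primrec

/-! ## Forbidden patterns -/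

section Patterns

variable {L : FirstOrder.Language.{0, 0}}

/-- Atoms about index variables and about variables without sort, both named by words: equations
between index variables, equations between variables without sort, equations between an index
variable and a function applied to index variables, and relations between index variables. -/
abbrev Atom (L : FirstOrder.Language.{0, 0}) : Type :=
  (List (Symbol L) × List (Symbol L)) ⊕ (List (Symbol L) × List (Symbol L)) ⊕
    ((Σ n, L.Functions n) × List (Symbol L) × List (List (Symbol L))) ⊕
    ((Σ n, L.Relations n) × List (List (Symbol L)))

/-- An equation between index variables. -/
abbrev eqI (u u' : List (Symbol L)) : Atom L := .inl (u, u')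

/-- An equation between variables without sort. -/
abbrev eqX (u u' : List (Symbol L)) : Atom L := .inr (.inl (u, u'))

/-- The index variable `u` is the value of `f` at the index variables `us`. -/
abbrev eqFn (f : Σ n, L.Functions n) (u : List (Symbol L)) (us : List (List (Symbol L))) :
    Atom L :=
  .inr (.inr (.inl (f, u, us)))

/-- The relation `R` holds for the index variables `us`. -/
abbrev relI (R : Σ n, L.Relations n) (us : List (List (Symbol L))) : Atom L :=
  .inr (.inr (.inr (R, us)))

/-- The variable `u` without sort has the value of the variable that stands for truth. -/
abbrev holds (u : List (Symbol L)) : Atom L := eqX u []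

/-- The order relation between index variables. -/
abbrev leI [L.IsOrdered] (u u' : List (Symbol L)) : Atom L := relI ⟨2, leSymb⟩ [u, u']

/-- A list of literals that must not hold at the same time. -/
abbrev Pattern (L : FirstOrder.Language.{0, 0}) : Type := List (Bool × Atom L)

/-- The word of `rd(a, i)`. -/
abbrev rdWord (a i : List (Symbol L)) : List (Symbol L) := .rd :: (a ++ i)

/-- The word of `diff(a, b)`. -/
abbrev diffWord (a b : List (Symbol L)) : List (Symbol L) := .diff :: (a ++ b)

/-- The word of `0`. -/
abbrev zeroWord (zero : L.Constants) : List (Symbol L) := [.fn ⟨0, zero⟩]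

/-- The two literal lists that exclude that `α` and `β` have different truth values. -/
def iffPatterns (α β : Atom L) : List (Pattern L) :=
  [ [(true, α), (false, β)], [(false, α), (true, β)] ]

/-- The words of kind `k` that have a node in `m`. -/
def wordsOfKind (k : Option ASort) (m : List (Node L)) : List (List (Symbol L)) :=
  m.flatMap fun n => if n.1 = k then [nodeWord n] else []

/-- The index words for the nodes in `m` and for the differences of the arrays in `m`. -/
def indexWords (m : List (Node L)) : List (List (Symbol L)) :=
  wordsOfKind (some .index) m ++ (wordsOfKind (some .array) m).flatMap fun a =>
    (wordsOfKind (some .array) m).map fun b => diffWord a b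

/-- The atom that expresses an equation between expressions of kind `k`. -/
def eqAtom (k : Option ASort) (p q : List (Symbol L)) : Atom L :=
  if k = some .array then eqX (rdWord p (diffWord p q)) (rdWord q (diffWord p q))
  else if k = some .index then eqI p q else eqX p q

variable [L.IsOrdered]

/-- Patterns excluded by the axiom of a write at the index `q` of the array `p`. -/
def writePatterns (zero : L.Constants) (I : List (List (Symbol L))) (u p q r : List (Symbol L)) :
    List (Pattern L) :=
  [(true, leI (zeroWord zero) q), (false, eqX (rdWord u q) r)] ::
    I.map fun t => [(false, eqI q t), (false, eqX (rdWord u t) (rdWord p t))]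

/-- Patterns excluded by the meaning of implication. -/
def impPatterns (u p q : List (Symbol L)) : List (Pattern L) :=
  [ [(true, holds p), (false, holds q), (true, holds u)], [(false, holds p), (false, holds u)],
    [(true, holds q), (false, holds u)] ]

/-- Patterns excluded by the meaning of the head symbol of a node. -/
def nodePatterns (zero : L.Constants) (I : List (List (Symbol L))) : Node L → List (Pattern L)
  | (k, .fn f, l) => [ [(false, eqFn f (nodeWord (k, .fn f, l)) (l.map Prod.snd))] ]
  | (k, .rel R, l) => iffPatterns (relI R (l.map Prod.snd)) (holds (nodeWord (k, .rel R, l)))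
  | (k, .wr, l) => writePatterns zero I (nodeWord (k, .wr, l)) (l.getD 0 default).2
      (l.getD 1 default).2 (l.getD 2 default).2
  | (k, .falsum, l) => [ [(true, holds (nodeWord (k, .falsum, l)))] ]
  | (k, .eq, l) => iffPatterns (eqAtom (l.getD 0 default).1 (l.getD 0 default).2
      (l.getD 1 default).2) (holds (nodeWord (k, .eq, l)))
  | (k, .imp, l) => impPatterns (nodeWord (k, .imp, l)) (l.getD 0 default).2 (l.getD 1 default).2
  | _ => []

/-- Patterns about one array and one index. -/
def readPatterns (zero : L.Constants) (I : List (List (Symbol L))) (a t : List (Symbol L)) :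
    List (Pattern L) :=
  [(true, leI t (zeroWord zero)), (false, eqI t (zeroWord zero)),
    (false, eqX (rdWord a t) [.bot])] ::
    I.map fun s => [(true, eqI t s), (false, eqX (rdWord a t) (rdWord a s))]

/-- Patterns about the difference of two arrays. -/
def diffPatterns (zero : L.Constants) (I : List (List (Symbol L))) (a b : List (Symbol L)) :
    List (Pattern L) :=
  [(true, eqX (rdWord a (diffWord a b)) (rdWord b (diffWord a b))),
    (false, eqI (diffWord a b) (zeroWord zero))] ::
    I.flatMap fun t =>
      [ [(true, leI (diffWord a b) t), (false, eqI (diffWord a b) t),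
        (false, eqX (rdWord a t) (rdWord b t))],
      [(true, eqX (rdWord a (diffWord a b)) (rdWord b (diffWord a b))),
        (false, eqX (rdWord a t) (rdWord b t))] ]

/-- All patterns that are excluded by the axioms and by the truth of the formula `w`. -/
def patterns (zero : L.Constants) (w : List (Symbol L)) (m : List (Node L)) : List (Pattern L) :=
  [(false, holds w)] ::
    ((indexWords m).map (fun t => [(false, eqX (rdWord [.eps] t) [.bot])]) ++
    m.flatMap (nodePatterns zero (indexWords m)) ++
    (wordsOfKind (some .array) m).flatMap (fun a =>
      (indexWords m).flatMap (readPatterns zero (indexWords m) a)) ++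
    (wordsOfKind (some .array) m).flatMap fun a =>
      (wordsOfKind (some .array) m).flatMap (diffPatterns zero (indexWords m) a))

/-- Nodes for the constants. -/
def constantNodes (zero : L.Constants) : List (Node L) :=
  [(some .index, .fn ⟨0, zero⟩, []), (some .array, .eps, []), (some .elem, .bot, [])]

variable [Primcodable (Σ n, L.Functions n)] [Primcodable (Σ n, L.Relations n)]

/-- The index variable for the word `u`. -/
def indexCode (u : List (Symbol L)) : ℕ := 2 * Encodable.encode u

/-- The variable without sort for the word `u`. -/
def freeCode (u : List (Symbol L)) : ℕ := 2 * Encodable.encode u + 1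

/-- An atom as a word. -/
def atomWord : Atom L → List (Symbol L) :=
  Sum.elim (fun x => [.eq, .indexVar (indexCode x.1), .indexVar (indexCode x.2)]) <|
  Sum.elim (fun x => [.eq, .indexVar (freeCode x.1), .indexVar (freeCode x.2)]) <|
  Sum.elim (fun x => .eq :: .indexVar (indexCode x.2.1) :: .fn x.1 ::
    x.2.2.map fun u => .indexVar (indexCode u))
  (fun x => .rel x.1 :: x.2.map fun u => .indexVar (indexCode u))

/-- A literal as a word. -/
def literalWord (l : Bool × Atom L) : List (Symbol L) :=
  bif l.1 then atomWord l.2 else .imp :: (atomWord l.2 ++ [.falsum])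

/-- The formula that excludes a pattern, as a word. -/
def patternWord (p : Pattern L) : List (Symbol L) :=
  p.foldr (fun l acc => .imp :: (literalWord l ++ acc)) [.falsum]

/-- The formula that excludes a list of patterns, as a word. -/
def patternsWord (ps : List (Pattern L)) : List (Symbol L) :=
  .imp :: (ps.foldr (fun p acc => .imp :: (patternWord p ++ acc)) [.falsum] ++ [.falsum])

/-- The translation of the formula `w`, given the results of parsing it. -/
def translate (zero : L.Constants) (w : List (Symbol L)) (Q : List (ParserState L)) :
    List (Symbol L) :=
  ((Q.flatMap fun S : ParserState L =>
    if S.1.map Prod.fst = [none] then [patternsWord (patterns zero w S.2)] else []) ++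
    [ [Symbol.falsum] ]).getD 0 []

/-- The translation of formulas of the array theory to formulas over `L`. -/
def reduction (zero : L.Constants) (w : List (Symbol L)) : List (Symbol L) :=
  translate zero w (run (constantNodes zero) w)

end Patterns

/-! ## Computability of the translation -/

section Computability

variable {L : FirstOrder.Language.{0, 0}}
variable [Primcodable (Σ n, L.Functions n)] [Primcodable (Σ n, L.Relations n)]

@[fun_prop]
theorem primrec_equivSum : Primrec (Symbol.equivSum L) := Primrec.of_equiv

theorem primrec_equivSum_symm : Primrec (Symbol.equivSum L).symm := Primrec.of_equiv_symm

variable {α : Type*} [Primcodable α]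

@[fun_prop]
theorem primrec_indexVar {f : α → ℕ} (hf : Primrec f) :
    Primrec fun a => (Symbol.indexVar (f a) : Symbol L) :=
  primrec_equivSum_symm.comp (primrec_inl (primrec_inr (primrec_inr (primrec_inl hf))))

@[fun_prop]
theorem primrec_fn {f : α → Σ n, L.Functions n} (hf : Primrec f) :
    Primrec fun a => Symbol.fn (f a) :=
  primrec_equivSum_symm.comp (primrec_inr (primrec_inl hf))

@[fun_prop]
theorem primrec_rel {f : α → Σ n, L.Relations n} (hf : Primrec f) :
    Primrec fun a => Symbol.rel (f a) :=
  primrec_equivSum_symm.comp (primrec_inr (primrec_inr (primrec_inl hf)))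

@[fun_prop]
theorem primrec_indexCode {f : α → List (Symbol L)} (hf : Primrec f) :
    Primrec fun a => indexCode (f a) :=
  Primrec.nat_mul.comp (Primrec.const 2) (Primrec.encode.comp hf)

@[fun_prop]
theorem primrec_freeCode {f : α → List (Symbol L)} (hf : Primrec f) :
    Primrec fun a => freeCode (f a) :=
  Primrec.succ.comp (primrec_indexCode hf)

@[fun_prop]
theorem primrec_nodeWord : Primrec (nodeWord (L := L)) := by
  unfold nodeWord
  fun_prop

@[fun_prop]
theorem primrec_atomWord : Primrec (atomWord (L := L)) := by
  unfold atomWord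
  fun_prop

@[fun_prop]
theorem primrec_literalWord : Primrec (literalWord (L := L)) := by
  unfold literalWord
  fun_prop

@[fun_prop]
theorem primrec_patternWord : Primrec (patternWord (L := L)) := by
  unfold patternWord
  fun_prop

@[fun_prop]
theorem primrec_patternsWord : Primrec (patternsWord (L := L)) := by
  unfold patternsWord
  fun_prop

@[fun_prop]
theorem primrec_wordsOfKind (k : Option ASort) : Primrec (wordsOfKind (L := L) k) := by
  unfold wordsOfKind
  fun_prop

@[fun_prop]
theorem primrec_indexWords : Primrec (indexWords (L := L)) := by
  unfold indexWords
  fun_prop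

/-- The signatures are part of the input, so the arities, which are only assumed computable, do not
enter. -/
theorem primrec_step : Primrec fun x : (Symbol L × List (List (Option ASort) × Option ASort)) ×
    List (ParserState L) => step x.1 x.2 := by
  unfold step push
  fun_prop

/-- The arities of function and relation symbols are needed only here; variables have constant
signatures within each sort, and the nine other symbols form a finite table. -/
theorem computable_signatures (hFun : Computable fun f : Σ n, L.Functions n => f.1)
    (hRel : Computable fun R : Σ n, L.Relations n => R.1) :
    Computable (signatures (L := L)) := by
  have hr : Primrec fun n : ℕ => List.replicate n (some ASort.index) :=
    (Primrec.list_map Primrec.list_range (Primrec₂.const (some ASort.index))).of_eq fun n => by simp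
  refine (Computable.sumCasesOn (f := Symbol.equivSum L)
    (g := fun _ => Sum.elim (fun _ => [([], some .array)]) <| Sum.elim
      (fun _ => [([], some .elem)]) <| Sum.elim (fun _ => [([], some .index)]) fun _ => [])
    (h := fun _ x => Sum.casesOn x (fun f => [(List.replicate f.1 (some .index), some .index)])
      fun x => Sum.casesOn x (fun R => [(List.replicate R.1 (some .index), none)])
      fun k => signatures ((Symbol.equivSum L).symm (.inr (.inr (.inr k)))))
    primrec_equivSum.to_comp (Primrec.to_comp ?_) ?_).of_eq fun s => by cases s <;> rfl
  · fun_prop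
  · refine Computable.sumCasesOn Computable.snd ?_ (Computable.sumCasesOn Computable.snd ?_ ?_)
    · exact Computable.list_cons.comp (((hr.to_comp.comp hFun).comp Computable.snd).pair
        (Computable.const _)) (Computable.const [])
    · exact Computable.list_cons.comp (((hr.to_comp.comp hRel).comp Computable.snd).pair
        (Computable.const _)) (Computable.const [])
    · exact (Primrec.dom_finite fun k : Fin 9 =>
        signatures ((Symbol.equivSum L).symm (.inr (.inr (.inr k))))).to_comp.comp Computable.snd

/-- All signatures are looked up before the run; the run over the annotated word is then a primitive
recursive fold. -/
theorem computable_run (hFun : Computable fun f : Σ n, L.Functions n => f.1)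
    (hRel : Computable fun R : Σ n, L.Relations n => R.1) (m₀ : List (Node L)) :
    Computable (run m₀) := by
  have h1 : Computable fun w : List (Symbol L) => w.map fun s => (s, signatures s) :=
    computable_map (Computable.id.pair (computable_signatures hFun hRel))
  have h2 : Primrec fun l : List (Symbol L × List (List (Option ASort) × Option ASort)) =>
      l.foldr step [([], m₀)] :=
    primrec_foldr primrec_id (primrec_const _) (h := fun _ => step)
      (primrec_step.comp Primrec.snd)
  exact h2.to_comp.comp h1

@[fun_prop]
theorem primrec_eqAtom {f : α → Option ASort} {g h : α → List (Symbol L)} (hf : Primrec f)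
    (hg : Primrec g) (hh : Primrec h) : Primrec fun a => eqAtom (f a) (g a) (h a) := by
  unfold eqAtom
  fun_prop

@[fun_prop]
theorem primrec_iffPatterns {f g : α → Atom L} (hf : Primrec f) (hg : Primrec g) :
    Primrec fun a => iffPatterns (f a) (g a) := by
  unfold iffPatterns
  fun_prop

@[fun_prop]
theorem primrec_impPatterns {f g h : α → List (Symbol L)} (hf : Primrec f) (hg : Primrec g)
    (hh : Primrec h) : Primrec fun a => impPatterns (f a) (g a) (h a) := by
  unfold impPatterns
  fun_prop

variable [L.IsOrdered]

@[fun_prop]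
theorem primrec_writePatterns (zero : L.Constants) {I : α → List (List (Symbol L))}
    {u p q r : α → List (Symbol L)} (hI : Primrec I) (hu : Primrec u) (hp : Primrec p)
    (hq : Primrec q) (hr : Primrec r) :
    Primrec fun a => writePatterns zero (I a) (u a) (p a) (q a) (r a) := by
  unfold writePatterns
  fun_prop

@[fun_prop]
theorem primrec_readPatterns (zero : L.Constants) {I : α → List (List (Symbol L))}
    {u p : α → List (Symbol L)} (hI : Primrec I) (hu : Primrec u) (hp : Primrec p) :
    Primrec fun a => readPatterns zero (I a) (u a) (p a) := by
  unfold readPatterns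
  fun_prop

@[fun_prop]
theorem primrec_diffPatterns (zero : L.Constants) {I : α → List (List (Symbol L))}
    {u p : α → List (Symbol L)} (hI : Primrec I) (hu : Primrec u) (hp : Primrec p) :
    Primrec fun a => diffPatterns zero (I a) (u a) (p a) := by
  unfold diffPatterns
  fun_prop

@[fun_prop]
theorem primrec_nodePatterns (zero : L.Constants) {I : α → List (List (Symbol L))}
    {n : α → Node L} (hI : Primrec I) (hn : Primrec n) :
    Primrec fun a => nodePatterns zero (I a) (n a) := by
  -- The match on the head symbol becomes a case distinction on its code: 3, 5, 6 and 7 are the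
  -- codes of `wr`, `falsum`, `eq` and `imp` in `Fin 9`.
  have h : Primrec fun x : List (List (Symbol L)) × Node L =>
      Sum.elim (fun _ => []) (Sum.elim
        (fun f => [ [(false, eqFn f (nodeWord x.2) (x.2.2.2.map Prod.snd))] ]) (Sum.elim
        (fun R => iffPatterns (relI R (x.2.2.2.map Prod.snd)) (holds (nodeWord x.2)))
        fun k => if k = 3 then writePatterns zero x.1 (nodeWord x.2) (x.2.2.2.getD 0 default).2
            (x.2.2.2.getD 1 default).2 (x.2.2.2.getD 2 default).2
          else if k = 5 then [ [(true, holds (nodeWord x.2))] ]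
          else if k = 6 then iffPatterns (eqAtom (x.2.2.2.getD 0 default).1
            (x.2.2.2.getD 0 default).2 (x.2.2.2.getD 1 default).2) (holds (nodeWord x.2))
          else if k = 7 then impPatterns (nodeWord x.2) (x.2.2.2.getD 0 default).2
            (x.2.2.2.getD 1 default).2
          else [])) (Symbol.equivSum L x.2.2.1) := by
    fun_prop
  refine (h.comp (hI.pair hn)).of_eq fun a => ?_
  obtain ⟨k, s, l⟩ := n a
  cases s <;> rfl

@[fun_prop]
theorem primrec_patterns (zero : L.Constants) {w : α → List (Symbol L)} {m : α → List (Node L)}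
    (hw : Primrec w) (hm : Primrec m) : Primrec fun a => patterns zero (w a) (m a) := by
  unfold patterns
  fun_prop

theorem primrec_translate (zero : L.Constants) : Primrec₂ (translate (L := L) zero) := by
  unfold Primrec₂ translate
  fun_prop

theorem computable_reduction (hFun : Computable fun f : Σ n, L.Functions n => f.1)
    (hRel : Computable fun R : Σ n, L.Relations n => R.1) (zero : L.Constants) :
    Computable (reduction zero) :=
  (primrec_translate zero).to_comp.comp Computable.id
    (computable_run hFun hRel (constantNodes zero))

end Computability

/-! ## Satisfiability of lists of patterns -/

section Satisfiability

variable {L : FirstOrder.Language.{0, 0}}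

/-- The number of arguments of the symbol in an atom is right. -/
def AtomValid : Atom L → Prop
  | .inl _ => True
  | .inr (.inl _) => True
  | .inr (.inr (.inl x)) => x.2.2.length = x.1.1
  | .inr (.inr (.inr x)) => x.2.length = x.1.1

/-- Truth of an atom, where the index variables are assigned elements of `I` and the variables
without sort are assigned elements of `X`. -/
def AtomHolds {I X : Type} [L.Structure I] (vI : List (Symbol L) → I) (vX : List (Symbol L) → X) :
    Atom L → Prop
  | .inl x => vI x.1 = vI x.2
  | .inr (.inl x) => vX x.1 = vX x.2
  | .inr (.inr (.inl x)) => ∃ h : x.2.2.length = x.1.1,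
      vI x.2.1 = Structure.funMap x.1.2 fun i => vI (x.2.2.get (i.cast h.symm))
  | .inr (.inr (.inr x)) => ∃ h : x.2.length = x.1.1,
      Structure.RelMap x.1.2 fun i => vI (x.2.get (i.cast h.symm))

/-- Truth of a literal. -/
def LiteralHolds {I X : Type} [L.Structure I] (vI : List (Symbol L) → I)
    (vX : List (Symbol L) → X) (l : Bool × Atom L) : Prop :=
  bif l.1 then AtomHolds vI vX l.2 else ¬ AtomHolds vI vX l.2

/-- Every pattern contains a false literal. -/
def Avoids {I X : Type} [L.Structure I] (vI : List (Symbol L) → I) (vX : List (Symbol L) → X)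
    (ps : List (Pattern L)) : Prop :=
  ∀ p ∈ ps, ¬ ∀ l ∈ p, LiteralHolds vI vX l

variable [Primcodable (Σ n, L.Functions n)] [Primcodable (Σ n, L.Relations n)]

/-- The index variable for `u` as a term. -/
def indexTerm (u : List (Symbol L)) : L.Term (ℕ ⊕ Fin 0) := .var (.inl (indexCode u))

open scoped Classical in
/-- An atom as a formula; equations between variables without sort are translated by `e`. -/
noncomputable def atomFormula (e : List (Symbol L) → List (Symbol L) → L.Formula ℕ) :
    Atom L → L.Formula ℕ
  | .inl x => .equal (indexTerm x.1) (indexTerm x.2)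
  | .inr (.inl x) => e x.1 x.2
  | .inr (.inr (.inl x)) => if h : x.2.2.length = x.1.1 then
      .equal (indexTerm x.2.1) (.func x.1.2 fun i => indexTerm (x.2.2.get (i.cast h.symm)))
      else .falsum
  | .inr (.inr (.inr x)) => if h : x.2.length = x.1.1 then
      .rel x.1.2 fun i => indexTerm (x.2.get (i.cast h.symm)) else .falsum

/-- A literal as a formula. -/
noncomputable def literalFormula (e : List (Symbol L) → List (Symbol L) → L.Formula ℕ)
    (l : Bool × Atom L) : L.Formula ℕ :=
  bif l.1 then atomFormula e l.2 else .imp (atomFormula e l.2) .falsum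

/-- The formula that excludes a pattern. -/
noncomputable def patternFormula (e : List (Symbol L) → List (Symbol L) → L.Formula ℕ)
    (p : Pattern L) : L.Formula ℕ :=
  p.foldr (fun l acc => .imp (literalFormula e l) acc) .falsum

/-- The formula that excludes a list of patterns. -/
noncomputable def patternsFormula (e : List (Symbol L) → List (Symbol L) → L.Formula ℕ)
    (ps : List (Pattern L)) : L.Formula ℕ :=
  .imp (ps.foldr (fun p acc => .imp (patternFormula e p) acc) .falsum) .falsum

theorem isQF_patternsFormula {e : List (Symbol L) → List (Symbol L) → L.Formula ℕ}
    (he : ∀ u u', (e u u').IsQF) (ps : List (Pattern L)) : (patternsFormula e ps).IsQF := by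
  have h1 : ∀ a, (atomFormula e a).IsQF := by
    rintro (x | x | x | x)
    · exact .of_isAtomic (.equal _ _)
    · exact he _ _
    · simp only [atomFormula]
      split_ifs
      · exact .of_isAtomic (.equal _ _)
      · exact .falsum
    · simp only [atomFormula]
      split_ifs
      · exact .of_isAtomic (.rel _ _)
      · exact .falsum
  have h2 : ∀ l, (literalFormula e l).IsQF := by
    rintro ⟨_ | _, a⟩
    · exact (h1 a).imp .falsum
    · exact h1 a
  have h3 : ∀ p, (patternFormula e p).IsQF := fun p => by
    induction p with
    | nil => exact .falsum
    | cons l p ih => exact (h2 l).imp ih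
  refine BoundedFormula.IsQF.imp ?_ .falsum
  induction ps with
  | nil => exact .falsum
  | cons l p ih => exact (h3 l).imp ih

/-- The translation `e` of unsorted equations is a parameter because two are used: `freeEq` for the
formula that is written out, and truth constants when stable infiniteness is applied. -/
theorem realize_patternsFormula {e : List (Symbol L) → List (Symbol L) → L.Formula ℕ}
    {I X : Type} [L.Structure I] {v : ℕ → I} {vX : List (Symbol L) → X}
    (he : ∀ u u', (e u u').Realize v ↔ vX u = vX u') (ps : List (Pattern L)) :
    (patternsFormula e ps).Realize v ↔ Avoids (fun u => v (indexCode u)) vX ps := by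
  have h1 : ∀ a, (atomFormula e a).Realize v ↔ AtomHolds (fun u => v (indexCode u)) vX a := by
    rintro (x | x | x | x)
    · exact Iff.rfl
    · exact he _ _
    · simp only [atomFormula, AtomHolds]
      split_ifs with h
      · simp only [h, exists_true_left]
        rfl
      · simp only [h, IsEmpty.exists_iff]
        rfl
    · simp only [atomFormula, AtomHolds]
      split_ifs with h
      · simp only [h, exists_true_left]
        rfl
      · simp only [h, IsEmpty.exists_iff]
        rfl
  have h2 : ∀ l, (literalFormula e l).Realize v ↔
      LiteralHolds (fun u => v (indexCode u)) vX l := by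
    rintro ⟨_ | _, a⟩
    · exact not_congr (h1 a)
    · exact h1 a
  have h3 : ∀ p, (patternFormula e p).Realize v ↔
      ¬ ∀ l ∈ p, LiteralHolds (fun u => v (indexCode u)) vX l := fun p => by
    induction p with
    | nil => exact iff_of_false (fun h => h) (by simp)
    | cons l p ih =>
      refine (imp_congr (h2 l) ih).trans ?_
      rw [List.forall_mem_cons, not_and]
  have h4 : Formula.Realize (ps.foldr (fun p acc => .imp (patternFormula e p) acc) .falsum) v ↔
      ¬ Avoids (fun u => v (indexCode u)) vX ps := by
    induction ps with
    | nil => exact iff_of_false (fun h => h) (by simp [Avoids])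
    | cons p ps ih =>
      refine (imp_congr (h3 p) ih).trans ?_
      unfold Avoids
      rw [List.forall_mem_cons, not_and]
  exact (not_congr h4).trans not_not

/-- The equation between variables without sort. -/
def freeEq (u u' : List (Symbol L)) : L.Formula ℕ :=
  .equal (.var (.inl (freeCode u))) (.var (.inl (freeCode u')))

/-- Correct arities are needed: `atomFormula` replaces an ill-formed atom by falsity, whereas
`atomWord` would write it out. -/
theorem formulaWord_patternsFormula {ps : List (Pattern L)}
    (hps : ∀ p ∈ ps, ∀ l ∈ p, AtomValid l.2) :
    formulaWord (patternsFormula freeEq ps) = patternsWord ps := by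
  have h0 : ∀ (us : List (List (Symbol L))) (n : ℕ) (h : us.length = n),
      ((List.finRange n).flatMap fun i => termWord (indexTerm (us.get (i.cast h.symm)))) =
        us.map fun u => Symbol.indexVar (indexCode u) := by
    rintro us _ rfl
    simp only [indexTerm, termWord, Fin.cast_eq_self]
    rw [← List.map_eq_flatMap]
    exact List.ext_getElem (by simp) (by simp)
  have h1 : ∀ a : Atom L, AtomValid a → formulaWord (atomFormula freeEq a) = atomWord a := by
    rintro (x | x | x | x) hx
    · rfl
    · rfl
    · simp only [AtomValid] at hx
      simp [atomFormula, hx, formulaWord, termWord, atomWord, indexTerm, ← h0 _ _ hx]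
    · simp only [AtomValid] at hx
      simp [atomFormula, hx, formulaWord, atomWord, ← h0 _ _ hx]
  have h2 : ∀ l : Bool × Atom L, AtomValid l.2 →
      formulaWord (literalFormula freeEq l) = literalWord l := by
    rintro ⟨_ | _, a⟩ h
    · simp [literalFormula, literalWord, formulaWord, h1 a h]
    · exact h1 a h
  have h3 : ∀ p : Pattern L, (∀ l ∈ p, AtomValid l.2) →
      formulaWord (patternFormula freeEq p) = patternWord p := fun p hp => by
    induction p with
    | nil => rfl
    | cons l p ih =>
      rw [List.forall_mem_cons] at hp
      have := ih hp.2
      simp only [patternFormula, patternWord] at this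
      simp [patternFormula, patternWord, formulaWord, h2 l hp.1, this]
  have h4 : formulaWord (n := 0)
      (ps.foldr (fun p acc => .imp (patternFormula freeEq p) acc) .falsum : L.Formula ℕ) =
      ps.foldr (fun p acc => .imp :: (patternWord p ++ acc)) [.falsum] := by
    induction ps with
    | nil => rfl
    | cons p ps ih =>
      rw [List.forall_mem_cons] at hps
      simp [formulaWord, h3 p hps.1, ih hps.2]
  simp only [patternsFormula, patternsWord, formulaWord, h4]

/-- Two sorts are merged into one. Unsorted variables occur in equations only, so just the pattern
of equalities among their values matters, and any infinite index model has room to copy it. -/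
theorem formulaSat_patternsWord_iff {T : L.Theory} (hT : StablyInfinite T)
    {ps : List (Pattern L)} (hps : ∀ p ∈ ps, ∀ l ∈ p, AtomValid l.2) :
    (∃ φ : L.Formula ℕ, φ.IsQF ∧ formulaWord φ = patternsWord ps ∧ FormulaSat T φ) ↔
      ∃ (I X : Type) (_ : L.Structure I) (vI : List (Symbol L) → I) (vX : List (Symbol L) → X),
        I ⊨ T ∧ Avoids vI vX ps := by
  classical
  constructor
  · rintro ⟨φ, -, hw, M, v, hv⟩
    rw [← formulaWord_patternsFormula hps] at hw
    rw [formulaWord_injective hw,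
      realize_patternsFormula (vX := fun u => v (freeCode u)) fun u u' => Iff.rfl] at hv
    exact ⟨M, M, inferInstance, _, _, M.is_model, hv⟩
  · rintro ⟨I, X, _, vI, vX, hI, h⟩
    have hI' : Nonempty I := ⟨vI []⟩
    -- Each unsorted equation is frozen to the truth value that `vX` gives it, so that the formula
    -- speaks of index variables only.
    let c : List (Symbol L) → List (Symbol L) → L.Formula ℕ := fun u u' =>
      if vX u = vX u' then .imp .falsum .falsum else .falsum
    have hc : ∀ {J : Type} [L.Structure J] (v : ℕ → J) (u u' : List (Symbol L)),
        (c u u').Realize v ↔ vX u = vX u' := fun v u u' => by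
      simp only [c]
      split_ifs with h
      · exact iff_of_true (fun h => h) h
      · exact iff_of_false (fun h => h) h
    -- Halving undoes `indexCode`; the default `vI []` serves numbers that code no word.
    let v : ℕ → I := fun n => (Encodable.decode (n / 2) : Option (List (Symbol L))).elim (vI []) vI
    have hv : ∀ u, v (indexCode u) = vI u := fun u => by simp [v, indexCode]
    have h1 : FormulaSat T (patternsFormula c ps) := by
      refine ⟨Theory.ModelType.of T I, v, (realize_patternsFormula (hc v) ps).2 ?_⟩
      simpa [hv] using h
    obtain ⟨N, hN, w, hw⟩ := hT _ (isQF_patternsFormula (fun u u' => by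
      simp only [c]
      split_ifs
      · exact .imp .falsum .falsum
      · exact .falsum) ps) h1
    rw [realize_patternsFormula (hc w) ps] at hw
    -- The values of `vX` are named by words, hence countable: a value goes to the point of `N`
    -- numbered by the code of a chosen word that has this value.
    let g : List (Symbol L) → N := fun u =>
      Infinite.natEmbedding N (Encodable.encode (Function.invFun vX (vX u)))
    have hg : ∀ u u', g u = g u' ↔ vX u = vX u' := fun u u' => by
      simp only [g, EmbeddingLike.apply_eq_iff_eq, Encodable.encode_inj]
      refine ⟨fun e => ?_, fun e => by rw [e]⟩
      rw [← Function.invFun_eq (f := vX) ⟨u, rfl⟩, e, Function.invFun_eq (f := vX) ⟨u', rfl⟩]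
    -- Index variables have even codes and keep the values given by the infinite model; unsorted
    -- variables have odd codes and receive the injected values.
    let x : ℕ → N := fun n => if n % 2 = 0 then w n else
      (Encodable.decode (n / 2) : Option (List (Symbol L))).elim (w 0) g
    have hx : ∀ u : List (Symbol L), x (indexCode u) = w (indexCode u) := fun u => by
      simp [x, indexCode]
    have hx' : ∀ u, x (freeCode u) = g u := fun u => by
      have : (2 * Encodable.encode u + 1) / 2 = Encodable.encode u := by omega
      simp [x, freeCode, this]
    refine ⟨_, isQF_patternsFormula (fun u u' => .of_isAtomic (.equal _ _)) ps,
      formulaWord_patternsFormula hps, N, x, ?_⟩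
    rw [realize_patternsFormula (vX := vX) fun u u' => ?_]
    · simpa [hx] using hw
    · rw [← hg, ← hx', ← hx']
      exact Iff.rfl

end Satisfiability

/-! ## What it means to avoid the patterns -/

section Avoids

variable {L : FirstOrder.Language.{0, 0}}

section

variable {I X : Type} [L.Structure I] {vI : List (Symbol L) → I} {vX : List (Symbol L) → X}

theorem avoids_nil : Avoids vI vX [] := by simp [Avoids]

theorem avoids_cons {p : Pattern L} {ps : List (Pattern L)} :
    Avoids vI vX (p :: ps) ↔ (¬ ∀ l ∈ p, LiteralHolds vI vX l) ∧ Avoids vI vX ps :=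
  List.forall_mem_cons

theorem avoids_append {ps qs : List (Pattern L)} :
    Avoids vI vX (ps ++ qs) ↔ Avoids vI vX ps ∧ Avoids vI vX qs :=
  List.forall_mem_append

theorem avoids_flatMap {ι : Type*} {l : List ι} {f : ι → List (Pattern L)} :
    Avoids vI vX (l.flatMap f) ↔ ∀ i ∈ l, Avoids vI vX (f i) := by
  simp only [Avoids, List.mem_flatMap]
  exact ⟨fun h i hi p hp => h p ⟨i, hi, hp⟩, fun h p ⟨i, hi, hp⟩ => h i hi p hp⟩

theorem avoids_map {ι : Type*} {l : List ι} {f : ι → Pattern L} :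
    Avoids vI vX (l.map f) ↔ ∀ i ∈ l, ¬ ∀ x ∈ f i, LiteralHolds vI vX x :=
  List.forall_mem_map

theorem literalHolds_true {a : Atom L} : LiteralHolds vI vX (true, a) ↔ AtomHolds vI vX a :=
  Iff.rfl

theorem literalHolds_false {a : Atom L} : LiteralHolds vI vX (false, a) ↔ ¬ AtomHolds vI vX a :=
  Iff.rfl

theorem atomHolds_eqI {u u' : List (Symbol L)} : AtomHolds vI vX (eqI u u') ↔ vI u = vI u' :=
  Iff.rfl

theorem atomHolds_eqX {u u' : List (Symbol L)} : AtomHolds vI vX (eqX u u') ↔ vX u = vX u' :=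
  Iff.rfl

theorem atomHolds_eqFn {n : ℕ} {f : L.Functions n} {u : List (Symbol L)}
    {us : Fin n → List (Symbol L)} :
    AtomHolds vI vX (eqFn ⟨n, f⟩ u ((List.finRange n).map us)) ↔
      vI u = Structure.funMap f fun i => vI (us i) := by
  simp [AtomHolds]

theorem atomHolds_relI {n : ℕ} {R : L.Relations n} {us : Fin n → List (Symbol L)} :
    AtomHolds vI vX (relI ⟨n, R⟩ ((List.finRange n).map us)) ↔
      Structure.RelMap R fun i => vI (us i) := by
  simp [AtomHolds]

theorem atomHolds_leI [L.IsOrdered] {u u' : List (Symbol L)} : AtomHolds vI vX (leI u u') ↔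
    Structure.RelMap (leSymb : L.Relations 2) ![vI u, vI u'] := by
  have : (fun i : Fin 2 => vI ([u, u'].get i)) = ![vI u, vI u'] := by
    funext i
    fin_cases i <;> rfl
  simp only [AtomHolds, List.length_cons, List.length_nil, exists_true_left, ← this]
  rfl

theorem avoids_iffPatterns {α β : Atom L} :
    Avoids vI vX (iffPatterns α β) ↔ (AtomHolds vI vX α ↔ AtomHolds vI vX β) := by
  simp only [iffPatterns, avoids_cons, avoids_nil, List.forall_mem_cons, literalHolds_true,
    literalHolds_false, and_true, List.not_mem_nil, IsEmpty.forall_iff, implies_true]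
  tauto

theorem avoids_impPatterns {u p q : List (Symbol L)} :
    Avoids vI vX (impPatterns u p q) ↔
      (vX u = vX [] ↔ (vX p = vX [] → vX q = vX [])) := by
  simp only [impPatterns, avoids_cons, avoids_nil, List.forall_mem_cons, literalHolds_true,
    literalHolds_false, and_true, List.not_mem_nil, IsEmpty.forall_iff, implies_true,
    atomHolds_eqX]
  tauto

end

theorem atomValid_of_mem_iffPatterns {α β : Atom L} (hα : AtomValid α) (hβ : AtomValid β) :
    ∀ p ∈ iffPatterns α β, ∀ l ∈ p, AtomValid l.2 := by
  simp only [iffPatterns, List.forall_mem_cons, List.not_mem_nil, IsEmpty.forall_iff,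
    implies_true, and_true, hα, hβ]

theorem isWord_of_mem_wordsOfKind {m : List (Node L)} (hm : NodesClosed m) {k : Option ASort}
    {u : List (Symbol L)} (hu : u ∈ wordsOfKind k m) : IsWord k u := by
  simp only [wordsOfKind, List.mem_flatMap] at hu
  obtain ⟨n, hn, hu⟩ := hu
  split_ifs at hu with h
  · simp only [List.mem_singleton] at hu
    rw [hu, ← h]
    exact (hm n hn).1.isWord
  · simp at hu

theorem isWord_of_mem_indexWords {m : List (Node L)} (hm : NodesClosed m)
    {u : List (Symbol L)} (hu : u ∈ indexWords m) : IsWord (some .index) u := by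
  simp only [indexWords, List.mem_append, List.mem_flatMap, List.mem_map] at hu
  rcases hu with hu | ⟨a, ha, b, hb, rfl⟩
  · exact isWord_of_mem_wordsOfKind hm hu
  · obtain ⟨a, rfl⟩ := isWord_of_mem_wordsOfKind hm ha
    obtain ⟨b, rfl⟩ := isWord_of_mem_wordsOfKind hm hb
    exact ⟨.diff a b, rfl⟩

/-! ## Values of expressions -/

section Values

variable (M : AStructure L) (v : ∀ s : ASort, ℕ → M.carrier s)

open scoped Classical in
/-- The value of the index term with a given word. -/
noncomputable def indexValue (zero : L.Constants) (u : List (Symbol L)) : M.Index :=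
  if h : ∃ t : ATerm L .index, t.word = u then M.eval v h.choose else M.zeroVal zero

open scoped Classical in
/-- The value of the element term or formula with a given word. -/
noncomputable def freeValue (u : List (Symbol L)) : M.carrier .elem ⊕ Prop :=
  if h : ∃ t : ATerm L .elem, t.word = u then .inl (M.eval v h.choose)
  else if h : ∃ φ : AFormula L, φ.word = u then .inr (M.Realize v h.choose) else .inr True

theorem indexValue_word (zero : L.Constants) (t : ATerm L .index) :
    indexValue M v zero t.word = M.eval v t := by
  have h : ∃ t' : ATerm L .index, t'.word = t.word := ⟨t, rfl⟩
  exact (dif_pos h).trans (congrArg (M.eval v) (ATerm.word_injective h.choose_spec))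

theorem freeValue_word (t : ATerm L .elem) : freeValue M v t.word = .inl (M.eval v t) := by
  have h : ∃ t' : ATerm L .elem, t'.word = t.word := ⟨t, rfl⟩
  rw [freeValue, dif_pos h, ATerm.word_injective h.choose_spec]

theorem freeValue_nil : freeValue M v [] = .inr True := by
  rw [freeValue, dif_neg fun ⟨t, h⟩ => IsWord.ne_nil (k := some .elem) ⟨t, h⟩ rfl,
    dif_neg fun ⟨t, h⟩ => IsWord.ne_nil (k := none) ⟨t, h⟩ rfl]

theorem freeValue_formula (φ : AFormula L) : freeValue M v φ.word = .inr (M.Realize v φ) := by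
  have h : ∃ φ' : AFormula L, φ'.word = φ.word := ⟨φ, rfl⟩
  rw [freeValue, dif_neg fun ⟨t, h⟩ => t.word_ne_formula φ [] [] (by rw [h]), dif_pos h,
    AFormula.word_injective h.choose_spec]

/-- Truth values are propositions in the right summand, and by propositional extensionality a
formula equals the truth variable exactly when it holds. -/
theorem freeValue_formula_eq_nil (φ : AFormula L) :
    freeValue M v φ.word = freeValue M v [] ↔ M.Realize v φ := by
  simp [freeValue_formula, freeValue_nil]

theorem freeValue_rd_eq (a b : ATerm L .array) (i j : ATerm L .index) :
    freeValue M v (rdWord a.word i.word) = freeValue M v (rdWord b.word j.word) ↔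
      M.rd (M.eval v a) (M.eval v i) = M.rd (M.eval v b) (M.eval v j) := by
  change freeValue M v (ATerm.rd a i).word = freeValue M v (ATerm.rd b j).word ↔ _
  rw [freeValue_word, freeValue_word, Sum.inl.injEq]
  rfl

theorem freeValue_rd_eq_word (a : ATerm L .array) (i : ATerm L .index) (e : ATerm L .elem) :
    freeValue M v (rdWord a.word i.word) = freeValue M v e.word ↔
      M.rd (M.eval v a) (M.eval v i) = M.eval v e := by
  change freeValue M v (ATerm.rd a i).word = _ ↔ _
  rw [freeValue_word, freeValue_word, Sum.inl.injEq]
  rfl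

theorem indexValue_diff (zero : L.Constants) (a b : ATerm L .array) :
    indexValue M v zero (diffWord a.word b.word) = M.diff (M.eval v a) (M.eval v b) :=
  indexValue_word M v zero (.diff a b)

theorem indexValue_zero (zero : L.Constants) :
    indexValue M v zero (zeroWord zero) = M.zeroVal zero := by
  refine (indexValue_word M v zero (.fn (n := 0) zero ![])).trans ?_
  simp only [AStructure.eval, AStructure.zeroVal]
  congr 1
  exact Subsingleton.elim _ _

end Values

/-! ### The patterns read as instances of the axioms -/

variable [L.IsOrdered]

/-- An assignment of index variables and variables without sort satisfies the instances of the
axioms about reading the array `a` at the index `t`, where `J` lists the indexes. -/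
structure ReadLaws {I X : Type} [L.Structure I] (vI : List (Symbol L) → I)
    (vX : List (Symbol L) → X) (zero : L.Constants) (J : List (List (Symbol L)))
    (a t : List (Symbol L)) : Prop where
  neg : Structure.RelMap (leSymb : L.Relations 2) ![vI t, vI (zeroWord zero)] →
    vI t ≠ vI (zeroWord zero) → vX (rdWord a t) = vX [.bot]
  congr : ∀ s ∈ J, vI t = vI s → vX (rdWord a t) = vX (rdWord a s)

/-- The instances of the axioms about the difference of `a` and `b`. -/
structure DiffLaws {I X : Type} [L.Structure I] (vI : List (Symbol L) → I)
    (vX : List (Symbol L) → X) (zero : L.Constants) (J : List (List (Symbol L)))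
    (a b : List (Symbol L)) : Prop where
  self : vX (rdWord a (diffWord a b)) = vX (rdWord b (diffWord a b)) →
    vI (diffWord a b) = vI (zeroWord zero)
  gt : ∀ t ∈ J, Structure.RelMap (leSymb : L.Relations 2) ![vI (diffWord a b), vI t] →
    vI (diffWord a b) ≠ vI t → vX (rdWord a t) = vX (rdWord b t)
  ext : ∀ t ∈ J, vX (rdWord a (diffWord a b)) = vX (rdWord b (diffWord a b)) →
    vX (rdWord a t) = vX (rdWord b t)

/-- The instances of the axioms about the array `u` that is obtained from `p` by writing `r` at
the index `q`. -/
structure WriteLaws {I X : Type} [L.Structure I] (vI : List (Symbol L) → I)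
    (vX : List (Symbol L) → X) (zero : L.Constants) (J : List (List (Symbol L)))
    (u p q r : List (Symbol L)) : Prop where
  same : Structure.RelMap (leSymb : L.Relations 2) ![vI (zeroWord zero), vI q] →
    vX (rdWord u q) = vX r
  other : ∀ t ∈ J, vI q ≠ vI t → vX (rdWord u t) = vX (rdWord p t)

/-- All instances of the axioms for the nodes in `m`, and the truth of `w`. -/
structure Laws {I X : Type} [L.Structure I] (vI : List (Symbol L) → I)
    (vX : List (Symbol L) → X) (zero : L.Constants) (w : List (Symbol L)) (m : List (Node L)) :
    Prop where
  root : vX w = vX []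
  eps : ∀ t ∈ indexWords m, vX (rdWord [.eps] t) = vX [.bot]
  node : ∀ n ∈ m, Avoids vI vX (nodePatterns zero (indexWords m) n)
  read : ∀ a ∈ wordsOfKind (some .array) m, ∀ t ∈ indexWords m,
    ReadLaws vI vX zero (indexWords m) a t
  diff : ∀ a ∈ wordsOfKind (some .array) m, ∀ b ∈ wordsOfKind (some .array) m,
    DiffLaws vI vX zero (indexWords m) a b

variable {I X : Type} [L.Structure I] {vI : List (Symbol L) → I} {vX : List (Symbol L) → X}
  {zero : L.Constants} {J : List (List (Symbol L))}

theorem avoids_readPatterns {a t : List (Symbol L)} :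
    Avoids vI vX (readPatterns zero J a t) ↔ ReadLaws vI vX zero J a t := by
  simp only [readPatterns, avoids_cons, avoids_map, List.forall_mem_cons, literalHolds_true,
    literalHolds_false, and_true, List.not_mem_nil, IsEmpty.forall_iff, implies_true,
    atomHolds_eqI, atomHolds_eqX, atomHolds_leI]
  constructor
  · rintro ⟨h1, h2⟩
    exact ⟨by tauto, by grind⟩
  · rintro ⟨h1, h2⟩
    exact ⟨by tauto, by grind⟩

theorem avoids_diffPatterns {a b : List (Symbol L)} :
    Avoids vI vX (diffPatterns zero J a b) ↔ DiffLaws vI vX zero J a b := by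
  simp only [diffPatterns, avoids_cons, avoids_flatMap, avoids_nil, List.forall_mem_cons,
    literalHolds_true, literalHolds_false, and_true, List.not_mem_nil, IsEmpty.forall_iff,
    implies_true, atomHolds_eqI, atomHolds_eqX, atomHolds_leI]
  constructor
  · rintro ⟨h1, h2⟩
    exact ⟨by tauto, by grind, by grind⟩
  · rintro ⟨h1, h2, h3⟩
    exact ⟨by tauto, by grind⟩

theorem avoids_writePatterns {u p q r : List (Symbol L)} :
    Avoids vI vX (writePatterns zero J u p q r) ↔ WriteLaws vI vX zero J u p q r := by
  simp only [writePatterns, avoids_cons, avoids_map, List.forall_mem_cons, literalHolds_true,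
    literalHolds_false, and_true, List.not_mem_nil, IsEmpty.forall_iff, implies_true,
    atomHolds_eqI, atomHolds_eqX, atomHolds_leI]
  constructor
  · rintro ⟨h1, h2⟩
    exact ⟨by tauto, by grind⟩
  · rintro ⟨h1, h2⟩
    exact ⟨by tauto, by grind⟩

theorem avoids_patterns {w : List (Symbol L)} {m : List (Node L)} :
    Avoids vI vX (patterns zero w m) ↔ Laws vI vX zero w m := by
  simp only [patterns, avoids_cons, avoids_append, avoids_map, avoids_flatMap,
    avoids_readPatterns, avoids_diffPatterns, List.forall_mem_cons, literalHolds_false,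
    and_true, List.not_mem_nil, IsEmpty.forall_iff, implies_true, atomHolds_eqX, not_not]
  constructor
  · rintro ⟨h1, ⟨⟨h2, h3⟩, h4⟩, h5⟩
    exact ⟨h1, h2, h3, h4, h5⟩
  · rintro ⟨h1, h2, h3, h4, h5⟩
    exact ⟨h1, ⟨⟨h2, h3⟩, h4⟩, h5⟩

theorem avoids_node_fn {n : ℕ} {f : L.Functions n} {ts : Fin n → ATerm L .index} :
    Avoids vI vX (nodePatterns zero J (ATerm.fn f ts).node) ↔
      vI (ATerm.fn f ts).word = Structure.funMap f fun i => vI (ts i).word := by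
  rw [← ATerm.nodeWord_node]
  simp only [ATerm.node, nodePatterns, avoids_cons, avoids_nil, List.forall_mem_cons,
    literalHolds_false, and_true, List.not_mem_nil, IsEmpty.forall_iff, implies_true, not_not,
    List.map_map, Function.comp_def, atomHolds_eqFn]

theorem avoids_node_wr {a : ATerm L .array} {i : ATerm L .index} {e : ATerm L .elem} :
    Avoids vI vX (nodePatterns zero J (ATerm.wr a i e).node) ↔
      WriteLaws vI vX zero J (ATerm.wr a i e).word a.word i.word e.word := by
  rw [← avoids_writePatterns, ← ATerm.nodeWord_node (.wr a i e)]
  rfl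

theorem avoids_node_falsum :
    Avoids vI vX (nodePatterns zero J (AFormula.falsum : AFormula L).node) ↔
      vX (AFormula.falsum : AFormula L).word ≠ vX [] := by
  rw [← AFormula.nodeWord_node]
  simp only [AFormula.node, nodePatterns, avoids_cons, avoids_nil, List.forall_mem_cons,
    literalHolds_true, and_true, List.not_mem_nil, IsEmpty.forall_iff, implies_true,
    atomHolds_eqX, ne_eq]

theorem avoids_node_eq {s : ASort} {t u : ATerm L s} :
    Avoids vI vX (nodePatterns zero J (AFormula.eq t u).node) ↔
      (AtomHolds vI vX (eqAtom (some s) t.word u.word) ↔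
        vX (AFormula.eq t u).word = vX []) := by
  rw [← AFormula.nodeWord_node]
  exact avoids_iffPatterns

theorem avoids_node_rel {n : ℕ} {R : L.Relations n} {ts : Fin n → ATerm L .index} :
    Avoids vI vX (nodePatterns zero J (AFormula.rel R ts).node) ↔
      (Structure.RelMap R (fun i => vI (ts i).word) ↔
        vX (AFormula.rel R ts).word = vX []) := by
  rw [← AFormula.nodeWord_node]
  refine avoids_iffPatterns.trans ?_
  rw [AFormula.node, List.map_map, Function.comp_def, atomHolds_relI]
  rfl

theorem avoids_node_imp {φ ψ : AFormula L} :
    Avoids vI vX (nodePatterns zero J (AFormula.imp φ ψ).node) ↔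
      (vX (AFormula.imp φ ψ).word = vX [] ↔ (vX φ.word = vX [] → vX ψ.word = vX [])) := by
  rw [← AFormula.nodeWord_node]
  exact avoids_impPatterns

/-! ## Well-formedness of the patterns -/

theorem atomValid_of_mem_nodePatterns {n : Node L} (hn : IsNode n) :
    ∀ p ∈ nodePatterns zero J n, ∀ l ∈ p, AtomValid l.2 := by
  rcases hn with ⟨s, t, rfl⟩ | ⟨φ, rfl⟩
  · cases t with
    | var s n => cases s <;> exact fun p hp => absurd hp List.not_mem_nil
    | fn f ts =>
      simp only [ATerm.node, nodePatterns, List.forall_mem_cons, List.not_mem_nil,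
        IsEmpty.forall_iff, implies_true, and_true]
      simp only [AtomValid, List.length_map, List.length_finRange]
    | wr a i e =>
      simp only [ATerm.node, nodePatterns, writePatterns, List.forall_mem_cons,
        List.forall_mem_map, List.not_mem_nil, IsEmpty.forall_iff, implies_true, and_true]
      exact ⟨⟨rfl, trivial⟩, fun _ _ => ⟨trivial, trivial⟩⟩
    | _ => exact fun p hp => absurd hp List.not_mem_nil
  · cases φ with
    | falsum =>
      simp only [AFormula.node, nodePatterns, List.forall_mem_cons, List.not_mem_nil,
        IsEmpty.forall_iff, implies_true, and_true]
      exact trivial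
    | @eq s t u => exact atomValid_of_mem_iffPatterns (by cases s <;> exact trivial) trivial
    | rel R ts =>
      exact atomValid_of_mem_iffPatterns
        (by simp only [AtomValid, List.length_map, List.length_finRange]) trivial
    | imp φ ψ =>
      simp only [AFormula.node, nodePatterns, impPatterns, List.forall_mem_cons, List.not_mem_nil,
        IsEmpty.forall_iff, implies_true, and_true]
      exact ⟨⟨trivial, trivial, trivial⟩, ⟨trivial, trivial⟩, trivial, trivial⟩

theorem atomValid_of_mem_patterns {m : List (Node L)} (hm : NodesClosed m)
    (w : List (Symbol L)) : ∀ p ∈ patterns zero w m, ∀ l ∈ p, AtomValid l.2 := by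
  simp only [patterns, List.forall_mem_cons, List.forall_mem_append, List.forall_mem_map,
    List.mem_flatMap, forall_exists_index, and_imp]
  refine ⟨by simp [AtomValid], ⟨⟨by simp [AtomValid], ?_⟩, ?_⟩, ?_⟩
  · exact fun p n hn hp => atomValid_of_mem_nodePatterns (hm n hn).1 p hp
  · intro p a _ t _ hp
    simp only [readPatterns, List.mem_cons, List.mem_map] at hp
    rcases hp with rfl | ⟨s, -, rfl⟩ <;> simp [AtomValid]
  · intro p a _ t _ hp
    simp only [diffPatterns, List.mem_cons, List.mem_flatMap, List.not_mem_nil, or_false] at hp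
    rcases hp with rfl | ⟨s, -, rfl | rfl⟩ <;> simp [AtomValid]

/-! ## From models of the array theory to assignments -/

variable {M : AStructure L} {v : ∀ s : ASort, ℕ → M.carrier s} {T : L.Theory}

/-- The contrapositive of the extensionality axiom for diff; it justifies the translation of array
equations in `eqAtom`. -/
theorem AStructure.IsModel.eq_iff (hM : M.IsModel zero T) (x y : M.Array) :
    M.rd x (M.diff x y) = M.rd y (M.diff x y) ↔ x = y :=
  ⟨fun h => by_contra fun hne => hM.rd_diff x y hne h, fun h => by rw [h]⟩

/-- All recorded words denote genuine terms and formulas, so once the variables take the values of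
these, each law is an instance of an axiom, a congruence, or a clause in the definition of truth. -/
theorem AStructure.IsModel.laws (hM : M.IsModel zero T) {φ : AFormula L} (hφ : M.Realize v φ)
    {m : List (Node L)} (hm : NodesClosed m) :
    Laws (indexValue M v zero) (freeValue M v) zero φ.word m := by
  refine ⟨(freeValue_formula_eq_nil M v φ).2 hφ, fun t ht => ?_, fun n hn => ?_,
    fun a ha t ht => ?_, fun a ha b hb => ?_⟩
  · obtain ⟨t, rfl⟩ := isWord_of_mem_indexWords hm ht
    exact (freeValue_rd_eq_word M v .eps t .bot).2 (hM.rd_eps _)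
  · rcases (hm n hn).1 with ⟨s, t, rfl⟩ | ⟨φ, rfl⟩
    · cases t with
      | var s n => cases s <;> exact avoids_nil
      | fn f ts =>
        rw [avoids_node_fn, indexValue_word]
        simp only [indexValue_word]
        rfl
      | wr a i e =>
        rw [avoids_node_wr]
        refine ⟨fun h => ?_, fun t ht h => ?_⟩
        · rw [freeValue_rd_eq_word]
          rw [indexValue_zero, indexValue_word] at h
          exact hM.rd_wr_same _ _ _ h
        · obtain ⟨t, rfl⟩ := isWord_of_mem_indexWords hm ht
          rw [freeValue_rd_eq]
          rw [indexValue_word, indexValue_word] at h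
          exact hM.rd_wr_other _ _ _ _ h
      | _ => exact avoids_nil
    · cases φ with
      | falsum =>
        rw [avoids_node_falsum, ne_eq, freeValue_formula_eq_nil]
        exact fun h => h
      | rel R ts =>
        rw [avoids_node_rel, freeValue_formula_eq_nil]
        simp only [indexValue_word]
        rfl
      | imp φ ψ =>
        rw [avoids_node_imp]
        simp only [freeValue_formula_eq_nil]
        rfl
      | @eq s t u =>
        rw [avoids_node_eq, freeValue_formula_eq_nil]
        cases s with
        | array =>
          refine Iff.trans ?_ (hM.eq_iff (M.eval v t) (M.eval v u))
          exact freeValue_rd_eq M v t u (.diff t u) (.diff t u)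
        | elem =>
          change freeValue M v _ = freeValue M v _ ↔ _
          rw [freeValue_word, freeValue_word, Sum.inl.injEq]
          rfl
        | index =>
          change indexValue M v zero _ = indexValue M v zero _ ↔ _
          rw [indexValue_word, indexValue_word]
          rfl
  · obtain ⟨a, rfl⟩ := isWord_of_mem_wordsOfKind hm ha
    obtain ⟨t, rfl⟩ := isWord_of_mem_indexWords hm ht
    refine ⟨fun h1 h2 => ?_, fun s hs h => ?_⟩
    · rw [indexValue_zero, indexValue_word] at h1 h2
      exact (freeValue_rd_eq_word M v a t .bot).2 (hM.rd_neg _ _ ⟨h1, h2⟩)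
    · obtain ⟨s, rfl⟩ := isWord_of_mem_indexWords hm hs
      rw [indexValue_word, indexValue_word] at h
      rw [freeValue_rd_eq, h]
  · obtain ⟨a, rfl⟩ := isWord_of_mem_wordsOfKind hm ha
    obtain ⟨b, rfl⟩ := isWord_of_mem_wordsOfKind hm hb
    -- Agreement at the difference means equality of the two arrays in `M`; the laws `self` and
    -- `ext` follow from it.
    have h0 : freeValue M v (rdWord a.word (diffWord a.word b.word)) =
        freeValue M v (rdWord b.word (diffWord a.word b.word)) ↔ M.eval v a = M.eval v b :=
      (freeValue_rd_eq M v a b (.diff a b) (.diff a b)).trans (hM.eq_iff _ _)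
    refine ⟨fun h => ?_, fun t ht h1 h2 => ?_, fun t ht h => ?_⟩
    · rw [indexValue_diff, indexValue_zero, h0.1 h]
      exact hM.diff_self _
    · obtain ⟨t, rfl⟩ := isWord_of_mem_indexWords hm ht
      rw [indexValue_diff, indexValue_word] at h1 h2
      exact (freeValue_rd_eq M v a b t t).2 (hM.rd_gt_diff _ _ _ ⟨h1, h2⟩)
    · obtain ⟨t, rfl⟩ := isWord_of_mem_indexWords hm ht
      rw [freeValue_rd_eq, h0.1 h]

end Avoids

/-! ## Arrays as functions -/

section FunctionModel

/-- Functions that have the value `b` at all but finitely many arguments and below `z`. -/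
abbrev FinArray {I X : Type} [LinearOrder I] (z : I) (b : X) : Type :=
  {g : I → X // {i | g i ≠ b}.Finite ∧ ∀ i < z, g i = b}

variable {I X : Type} [LinearOrder I] {z : I} {b : X}

theorem FinArray.apply_of_lt (x : FinArray z b) {i : I} (h : i < z) : x.1 i = b := x.2.2 i h

/-- The places of difference lie in the union of two finite supports, and a nonempty finite set in a
linear order has a greatest element. -/
theorem FinArray.exists_diff (x y : FinArray z b) :
    ∃ d, (x = y → d = z) ∧ (x ≠ y → x.1 d ≠ y.1 d ∧ ∀ i, d < i → x.1 i = y.1 i) := by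
  by_cases h : x = y
  · exact ⟨z, fun _ => rfl, fun h' => absurd h h'⟩
  · have hfin : {i | x.1 i ≠ y.1 i}.Finite := by
      refine (x.2.1.union y.2.1).subset fun i hi => ?_
      by_contra hn
      simp only [Set.mem_union, Set.mem_ofPred_eq, not_or, not_not] at hn
      exact hi (hn.1.trans hn.2.symm)
    obtain ⟨j, hj⟩ : ∃ j, x.1 j ≠ y.1 j := by
      by_contra! hn
      exact h (Subtype.ext (funext hn))
    obtain ⟨d, hd, hmax⟩ := Set.exists_max_image _ id hfin ⟨j, hj⟩
    refine ⟨d, fun h' => absurd h' h, fun _ => ⟨hd, fun i hi => ?_⟩⟩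
    by_contra hn
    exact absurd (hmax i hn) (not_le.2 hi)

/-- The largest index at which two arrays differ, and `z` if they are equal. -/
noncomputable def FinArray.diff (x y : FinArray z b) : I := (x.exists_diff y).choose

theorem FinArray.diff_self (x : FinArray z b) : x.diff x = z :=
  (FinArray.exists_diff x x).choose_spec.1 rfl

theorem FinArray.diff_ne {x y : FinArray z b} (h : x ≠ y) :
    x.1 (x.diff y) ≠ y.1 (x.diff y) :=
  ((FinArray.exists_diff x y).choose_spec.2 h).1

theorem FinArray.diff_lt {x y : FinArray z b} {i : I}
    (h : x.diff y < i) : x.1 i = y.1 i := by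
  by_cases hxy : x = y
  · rw [hxy]
  · exact ((FinArray.exists_diff x y).choose_spec.2 hxy).2 i h

/-- Lets the difference of interpreted arrays be computed without unfolding the choice in
`FinArray.diff`. -/
theorem FinArray.diff_unique {x y : FinArray z b} {d : I} (h : x.1 d ≠ y.1 d)
    (hlt : ∀ i, d < i → x.1 i = y.1 i) : x.diff y = d := by
  have hxy : x ≠ y := fun e => h (by rw [e])
  rcases lt_trichotomy (x.diff y) d with h' | h' | h'
  · exact absurd (FinArray.diff_lt h') h
  · exact h'
  · exact absurd (hlt _ h') (FinArray.diff_ne hxy)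

/-- The array that agrees with `x` except for the value `e` at `i`, if `i` is not below `z`. -/
def FinArray.write (x : FinArray z b) (i : I) (e : X) : FinArray z b :=
  if h : z ≤ i then
    ⟨Function.update x.1 i e, by
      refine (x.2.1.insert i).subset fun j hj => ?_
      by_cases hji : j = i
      · exact .inl hji
      · refine .inr ?_
        simpa [Function.update_of_ne hji] using hj, fun j hj => by
      rw [Function.update_of_ne (hj.trans_le h).ne]
      exact x.2.2 j hj⟩
  else x

theorem FinArray.write_same (x : FinArray z b) {i : I} (h : z ≤ i) (e : X) :
    (x.write i e).1 i = e := by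
  simp [FinArray.write, h]

theorem FinArray.write_other (x : FinArray z b) {i j : I} (h : i ≠ j) (e : X) :
    (x.write i e).1 j = x.1 j := by
  unfold FinArray.write
  split_ifs
  · exact Function.update_of_ne h.symm _ _
  · rfl

variable {L : FirstOrder.Language.{0, 0}} [L.Structure I]

variable (L z b) in
/-- The structure whose arrays are functions with finite support. -/
noncomputable def functionModel : AStructure L where
  Array := FinArray z b
  Elem := X
  Index := I
  rd x i := x.1 i
  wr x i e := x.write i e
  diff x y := x.diff y
  eps := ⟨fun _ => b, by simp, fun _ _ => rfl⟩
  bot := b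

variable [L.IsOrdered] [L.OrderedStructure I]

theorem functionModel_le (i j : I) : (functionModel z b L).le i j ↔ i ≤ j :=
  relMap_leSymb (L := L) (M := I) ![i, j]

theorem functionModel_lt (i j : I) : (functionModel z b L).lt i j ↔ i < j :=
  (and_congr_left' (functionModel_le i j)).trans lt_iff_le_and_ne.symm

theorem functionModel_isModel {T : L.Theory} (hI : I ⊨ T) {zero : L.Constants}
    (hz : Structure.funMap (M := I) zero ![] = z) : (functionModel z b L).IsModel zero T where
  index_model := hI
  rd_wr_same y i e h := by
    have hz' : (functionModel z b L).zeroVal zero = z := hz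
    rw [hz'] at h
    exact FinArray.write_same y ((functionModel_le z i).1 h) e
  rd_wr_other y i j e h := FinArray.write_other y h e
  rd_diff x y h := FinArray.diff_ne h
  rd_gt_diff x y i h := FinArray.diff_lt (I := I) ((functionModel_lt (I := I) _ i).1 h)
  diff_self x := (FinArray.diff_self x).trans hz.symm
  rd_neg x i h := by
    have hz' : (functionModel z b L).zeroVal zero = z := hz
    rw [hz'] at h
    exact FinArray.apply_of_lt (I := I) x ((functionModel_lt (I := I) i z).1 h)
  rd_eps i := rfl

end FunctionModel

/-! ## From assignments to models of the array theory -/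

section Assignments

variable {L : FirstOrder.Language.{0, 0}}

theorem NodesClosed.term_mem {m : List (Node L)} (hm : NodesClosed m) {n : Node L} (hn : n ∈ m)
    {s : ASort} {t : ATerm L s} (ht : (some s, t.word) ∈ n.2.2) : t.node ∈ m := by
  obtain ⟨n', hn', e⟩ := (hm n hn).2 _ ht
  rwa [(hm n' hn').1.eq_term_node (congrArg Prod.snd e)] at hn'

theorem NodesClosed.formula_mem {m : List (Node L)} (hm : NodesClosed m) {n : Node L}
    (hn : n ∈ m) {φ : AFormula L} (hφ : (none, φ.word) ∈ n.2.2) : φ.node ∈ m := by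
  obtain ⟨n', hn', e⟩ := (hm n hn).2 _ hφ
  rwa [(hm n' hn').1.eq_formula_node (congrArg Prod.snd e)] at hn'

theorem ATerm.word_mem_wordsOfKind {m : List (Node L)} {s : ASort} {t : ATerm L s}
    (ht : t.node ∈ m) : t.word ∈ wordsOfKind (some s) m := by
  simp only [wordsOfKind, List.mem_flatMap]
  exact ⟨_, ht, by simp [t.node_fst, t.nodeWord_node]⟩

theorem ATerm.word_mem_indexWords {m : List (Node L)} {t : ATerm L .index}
    (ht : t.node ∈ m) : t.word ∈ indexWords m :=
  List.mem_append_left _ (ATerm.word_mem_wordsOfKind ht)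

theorem diffWord_mem_indexWords {m : List (Node L)} {a b : List (Symbol L)}
    (ha : a ∈ wordsOfKind (some .array) m) (hb : b ∈ wordsOfKind (some .array) m) :
    diffWord a b ∈ indexWords m :=
  List.mem_append_right _
    (List.mem_flatMap.2 ⟨a, ha, List.mem_map.2 ⟨b, hb, rfl⟩⟩)

theorem nodesClosed_constantNodes {zero : L.Constants} : NodesClosed (constantNodes zero) := by
  simp only [NodesClosed, constantNodes, List.forall_mem_cons, List.not_mem_nil,
    IsEmpty.forall_iff, implies_true, and_true]
  refine ⟨.inl ⟨_, .fn (n := 0) zero ![], rfl⟩, .inl ⟨_, .eps, rfl⟩, .inl ⟨_, .bot, rfl⟩⟩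

variable {I X : Type} [LinearOrder I] (vI : List (Symbol L) → I) (vX : List (Symbol L) → X)
  (z : I) (J : List (List (Symbol L)))

open scoped Classical in
/-- The array that has the values of the variables for `rd(u, t)`, where `t` is in `J`. -/
noncomputable def arrayValue (u : List (Symbol L)) : FinArray z (vX [.bot]) :=
  ⟨fun i => if h : z ≤ i ∧ ∃ t ∈ J, vI t = i then vX (rdWord u h.2.choose) else vX [.bot], by
    refine ((List.finite_toSet J).image vI).subset fun i hi => ?_
    by_contra hn
    refine hi (dif_neg fun h => hn ?_)
    obtain ⟨-, t, ht, e⟩ := h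
    exact ⟨t, ht, e⟩, fun i hi => dif_neg fun h => absurd h.1 (not_le.2 hi)⟩

variable {vI vX z J}

theorem arrayValue_of_forall_ne {u : List (Symbol L)} {i : I} (h : ∀ t ∈ J, vI t ≠ i) :
    (arrayValue vI vX z J u).1 i = vX [.bot] :=
  dif_neg fun ⟨_, t, ht, e⟩ => h t ht e

variable [L.Structure I]

variable (vI vX z J) in
/-- The values of the variables for terms, where arrays are functions. -/
noncomputable def termValue : ∀ s : ASort, List (Symbol L) →
    (functionModel z (vX [.bot]) L).carrier s
  | .array, u => arrayValue vI vX z J u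
  | .elem, u => vX u
  | .index, u => vI u

variable (vI vX z J) in
/-- The assignment given by the variables for words of length one. -/
noncomputable def termAssignment (s : ASort) (n : ℕ) :
    (functionModel z (vX [.bot]) L).carrier s :=
  termValue vI vX z J s [varSymbol s n]

variable [L.IsOrdered] [L.OrderedStructure I] {zero : L.Constants}

/-- By the law `congr` it does not matter which listed word was chosen for an index; below zero, the
law `neg` gives the value ⊥ that arrays must have there. -/
theorem arrayValue_apply {a t : List (Symbol L)} (h : ReadLaws vI vX zero J a t)
    (hz : vI (zeroWord zero) = z) (ht : t ∈ J) :
    (arrayValue vI vX z J a).1 (vI t) = vX (rdWord a t) := by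
  simp only [arrayValue]
  split_ifs with h'
  · exact (h.congr _ h'.2.choose_spec.1 h'.2.choose_spec.2.symm).symm
  · have hlt : vI t < z := not_le.1 fun h'' => h' ⟨h'', t, ht, rfl⟩
    rw [← hz] at hlt
    exact (h.neg ((relMap_leSymb _).2 hlt.le) hlt.ne).symm

/-- The difference is itself a listed index, so an equality of arrays can be tested there.
Conversely, the law `ext` carries agreement there to all listed indexes, and elsewhere both arrays
are ⊥. -/
theorem arrayValue_eq_iff {m : List (Node L)} {w : List (Symbol L)} (h : Laws vI vX zero w m)
    (hz : vI (zeroWord zero) = z) {a b : List (Symbol L)}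
    (ha : a ∈ wordsOfKind (some .array) m) (hb : b ∈ wordsOfKind (some .array) m) :
    arrayValue vI vX z (indexWords m) a = arrayValue vI vX z (indexWords m) b ↔
      vX (rdWord a (diffWord a b)) = vX (rdWord b (diffWord a b)) := by
  have hd := diffWord_mem_indexWords ha hb
  constructor
  · intro e
    rw [← arrayValue_apply (h.read a ha _ hd) hz hd, ← arrayValue_apply (h.read b hb _ hd) hz hd, e]
  · intro e
    refine Subtype.ext (funext fun i => ?_)
    by_cases hi : ∃ t ∈ indexWords m, vI t = i
    · obtain ⟨t, ht, rfl⟩ := hi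
      rw [arrayValue_apply (h.read a ha _ ht) hz ht, arrayValue_apply (h.read b hb _ ht) hz ht]
      exact (h.diff a ha b hb).ext t ht e
    · push Not at hi
      rw [arrayValue_of_forall_ne hi, arrayValue_of_forall_ne hi]

/-- For unequal arrays, the law `gt` handles the listed indexes above the difference, and at the
others both arrays are ⊥. For equal arrays, the law `self` gives zero. -/
theorem diff_arrayValue {m : List (Node L)} {w : List (Symbol L)}
    (h : Laws vI vX zero w m) (hz : vI (zeroWord zero) = z) {a b : List (Symbol L)}
    (ha : a ∈ wordsOfKind (some .array) m) (hb : b ∈ wordsOfKind (some .array) m) :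
    (arrayValue vI vX z (indexWords m) a).diff (arrayValue vI vX z (indexWords m) b) =
      vI (diffWord a b) := by
  have hd := diffWord_mem_indexWords ha hb
  have heq := arrayValue_eq_iff h hz ha hb
  by_cases e : vX (rdWord a (diffWord a b)) = vX (rdWord b (diffWord a b))
  · rw [heq.2 e]
    exact (FinArray.diff_self _).trans (hz.symm.trans ((h.diff a ha b hb).self e).symm)
  · refine FinArray.diff_unique ?_ fun i hi => ?_
    · rwa [arrayValue_apply (h.read a ha _ hd) hz hd, arrayValue_apply (h.read b hb _ hd) hz hd]
    · by_cases hi' : ∃ t ∈ indexWords m, vI t = i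
      · obtain ⟨t, ht, rfl⟩ := hi'
        rw [arrayValue_apply (h.read a ha _ ht) hz ht, arrayValue_apply (h.read b hb _ ht) hz ht]
        exact (h.diff a ha b hb).gt t ht ((relMap_leSymb _).2 hi.le) hi.ne
      · push Not at hi'
        rw [arrayValue_of_forall_ne hi', arrayValue_of_forall_ne hi']

theorem arrayValue_write {m : List (Node L)} {w : List (Symbol L)}
    (h : Laws vI vX zero w m) (hz : vI (zeroWord zero) = z) {u a i e : List (Symbol L)}
    (hu : u ∈ wordsOfKind (some .array) m) (ha : a ∈ wordsOfKind (some .array) m)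
    (hi : i ∈ indexWords m) (hw : WriteLaws vI vX zero (indexWords m) u a i e) :
    (arrayValue vI vX z (indexWords m) a).write (vI i) (vX e) =
      arrayValue vI vX z (indexWords m) u := by
  refine Subtype.ext (funext fun j => ?_)
  by_cases hj : vI i = j
  · subst hj
    by_cases hle : z ≤ vI i
    · rw [FinArray.write_same _ hle, arrayValue_apply (h.read u hu _ hi) hz hi]
      refine (hw.same ((relMap_leSymb _).2 ?_)).symm
      rw [hz]
      exact hle
    -- At a negative index a write has no effect, and both arrays are ⊥ there.
    · exact (FinArray.apply_of_lt _ (not_le.1 hle)).trans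
        (FinArray.apply_of_lt _ (not_le.1 hle)).symm
  · rw [FinArray.write_other _ hj]
    by_cases hj' : ∃ t ∈ indexWords m, vI t = j
    · obtain ⟨t, ht, rfl⟩ := hj'
      rw [arrayValue_apply (h.read a ha _ ht) hz ht, arrayValue_apply (h.read u hu _ ht) hz ht]
      exact (hw.other t ht hj).symm
    · push Not at hj'
      rw [arrayValue_of_forall_ne hj', arrayValue_of_forall_ne hj']

/-- Induction on the term: closure of `m` supplies the nodes of the arguments, and each symbol is
handled by its law. Variables agree by definition, since the assignment is read off from one-letter
words. -/
theorem eval_termAssignment {m : List (Node L)} {w : List (Symbol L)}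
    (h : Laws vI vX zero w m) (hm : NodesClosed m)
    (hz : vI (zeroWord zero) = z) {s : ASort} (t : ATerm L s) (ht : t.node ∈ m) :
    (functionModel z (vX [.bot]) L).eval (termAssignment vI vX z (indexWords m)) t =
      termValue vI vX z (indexWords m) s t.word := by
  induction t with
  | var s n => rfl
  | fn f ts ih =>
    have ih' := fun i => ih i (hm.term_mem ht (by simp [ATerm.node]))
    simp only [AStructure.eval, ih']
    exact (avoids_node_fn.1 (h.node _ ht)).symm
  | eps =>
    have he : [Symbol.eps] ∈ wordsOfKind (some .array) m := ATerm.word_mem_wordsOfKind ht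
    refine Subtype.ext (funext fun j => ?_)
    by_cases hj : ∃ t ∈ indexWords m, vI t = j
    · obtain ⟨t, ht, rfl⟩ := hj
      exact (h.eps t ht).symm.trans (arrayValue_apply (h.read _ he _ ht) hz ht).symm
    · push Not at hj
      exact (arrayValue_of_forall_ne hj).symm
  | bot => rfl
  | rd a i iha ihi =>
    have ha : a.node ∈ m := hm.term_mem ht (by simp [ATerm.node])
    have hi : i.node ∈ m := hm.term_mem ht (by simp [ATerm.node])
    simp only [AStructure.eval, iha ha, ihi hi]
    have hi' := ATerm.word_mem_indexWords hi
    exact arrayValue_apply (h.read _ (ATerm.word_mem_wordsOfKind ha) _ hi') hz hi'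
  | wr a i e iha ihi ihe =>
    have ha : a.node ∈ m := hm.term_mem ht (by simp [ATerm.node])
    have hi : i.node ∈ m := hm.term_mem ht (by simp [ATerm.node])
    have he : e.node ∈ m := hm.term_mem ht (by simp [ATerm.node])
    simp only [AStructure.eval, iha ha, ihi hi, ihe he]
    exact arrayValue_write h hz (ATerm.word_mem_wordsOfKind ht) (ATerm.word_mem_wordsOfKind ha)
      (ATerm.word_mem_indexWords hi) (avoids_node_wr.1 (h.node _ ht))
  | diff a b iha ihb =>
    have ha : a.node ∈ m := hm.term_mem ht (by simp [ATerm.node])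
    have hb : b.node ∈ m := hm.term_mem ht (by simp [ATerm.node])
    simp only [AStructure.eval, iha ha, ihb hb]
    exact diff_arrayValue h hz (ATerm.word_mem_wordsOfKind ha)
      (ATerm.word_mem_wordsOfKind hb)

theorem realize_termAssignment {m : List (Node L)} {w : List (Symbol L)}
    (h : Laws vI vX zero w m) (hm : NodesClosed m)
    (hz : vI (zeroWord zero) = z) (φ : AFormula L) (hφ : φ.node ∈ m) :
    (functionModel z (vX [.bot]) L).Realize (termAssignment vI vX z (indexWords m)) φ ↔
      vX φ.word = vX [] := by
  induction φ with
  | falsum => exact iff_of_false (fun h => h) (avoids_node_falsum.1 (h.node _ hφ))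
  | rel R ts =>
    have ih := fun i => eval_termAssignment h hm hz (ts i)
      (hm.term_mem hφ (by simp [AFormula.node]))
    rw [← avoids_node_rel.1 (h.node _ hφ)]
    simp only [AStructure.Realize, ih]
    rfl
  | imp φ ψ ih1 ih2 =>
    rw [avoids_node_imp.1 (h.node _ hφ)]
    exact imp_congr (ih1 (hm.formula_mem hφ (by simp [AFormula.node])))
      (ih2 (hm.formula_mem hφ (by simp [AFormula.node])))
  | @eq s t u =>
    have ht : t.node ∈ m := hm.term_mem hφ (by simp [AFormula.node])
    have hu : u.node ∈ m := hm.term_mem hφ (by simp [AFormula.node])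
    rw [← avoids_node_eq.1 (h.node _ hφ)]
    simp only [AStructure.Realize, eval_termAssignment h hm hz t ht,
      eval_termAssignment h hm hz u hu]
    cases s with
    | array =>
      exact arrayValue_eq_iff h hz (ATerm.word_mem_wordsOfKind ht) (ATerm.word_mem_wordsOfKind hu)
    | elem => exact Iff.rfl
    | index => exact Iff.rfl

end Assignments

/-! ### Correctness of the reduction -/

section Reduction

variable {L : FirstOrder.Language.{0, 0}} [L.IsOrdered] {zero : L.Constants}

/-- The node of 0 is always recorded, also when 0 does not occur in the formula, and its pattern
forces the value of the constant. -/
theorem Laws.zero_eq {I X : Type} [L.Structure I] {vI : List (Symbol L) → I}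
    {vX : List (Symbol L) → X} {m : List (Node L)} {w : List (Symbol L)}
    (h : Laws vI vX zero w m) (hm₀ : constantNodes zero ⊆ m) :
    vI (zeroWord zero) = Structure.funMap zero ![] := by
  have h' := avoids_node_fn.1 (h.node (ATerm.fn (n := 0) zero ![]).node (hm₀ (by
    simp [constantNodes, ATerm.node])))
  refine h'.trans ?_
  congr 1
  exact Subsingleton.elim _ _

theorem Laws.ardSat {T : L.Theory} (hT : ∀ φ ∈ L.linearOrderTheory, T ⊨ᵇ φ) {I X : Type}
    [L.Structure I] {vI : List (Symbol L) → I} {vX : List (Symbol L) → X} (hI : I ⊨ T)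
    {φ : AFormula L} {m : List (Node L)} (h : Laws vI vX zero φ.word m) (hm : NodesClosed m)
    (hm₀ : constantNodes zero ⊆ m) (hφ : φ.node ∈ m) : ARDSat zero T φ := by
  classical
  have : Nonempty I := ⟨vI []⟩
  -- The order on `I` is defined by its interpretation of the symbol ≤, so the compatibility of the
  -- two holds by construction.
  have : I ⊨ L.linearOrderTheory := (Theory.model_iff _).2 fun φ hφ =>
    Theory.models_sentence_iff.1 (hT φ hφ) (Theory.ModelType.of T I)
  let := L.linearOrderOfModels I
  have : L.OrderedStructure I := inferInstanceAs (@OrderedStructure L I _ (L.leOfStructure I) _)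
  exact ⟨_, functionModel_isModel (b := vX [.bot]) hI (h.zero_eq hm₀).symm, _,
    (realize_termAssignment h hm rfl φ hφ).2 h.root⟩

variable [Primcodable (Σ n, L.Functions n)] [Primcodable (Σ n, L.Relations n)]

/-- If no run ends with a single formula on the stack, completeness shows that `w` is not a formula
and the default output falsum is used. Otherwise the first such run is taken; by soundness any such
run would do. -/
theorem reduction_eq (w : List (Symbol L)) :
    (reduction zero w = [.falsum] ∧ ∀ φ : AFormula L, φ.word ≠ w) ∨
      ∃ (φ : AFormula L) (m : List (Node L)), φ.word = w ∧
        reduction zero w = patternsWord (patterns zero w m) ∧ NodesClosed m ∧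
        constantNodes zero ⊆ m ∧ φ.node ∈ m := by
  unfold reduction translate
  generalize hl : ((run (constantNodes zero) w).flatMap fun S : ParserState L =>
    if S.1.map Prod.fst = [none] then [patternsWord (patterns zero w S.2)] else []) = l
  rcases l with _ | ⟨x, l⟩
  · refine .inl ⟨rfl, ?_⟩
    rintro φ rfl
    obtain ⟨m, hm⟩ := φ.run_complete (m₀ := constantNodes zero) [] [] ⟨_, List.mem_singleton_self _⟩
    rw [List.append_nil] at hm
    rw [List.flatMap_eq_nil_iff] at hl
    simpa using hl _ hm
  · refine .inr ?_
    obtain ⟨⟨st, m⟩, hS, hx⟩ := List.mem_flatMap.1 (hl ▸ List.mem_cons_self : x ∈ List.flatMap _ _)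
    split_ifs at hx with hst
    · simp only [List.mem_singleton] at hx
      subst hx
      obtain ⟨h1, h2, h3, h4⟩ := run_sound nodesClosed_constantNodes hS
      simp only [List.map_eq_cons_iff, List.map_eq_nil_iff] at hst
      obtain ⟨⟨k, u⟩, _, rfl, rfl, rfl⟩ := hst
      simp only [List.flatMap_cons, List.flatMap_nil, List.append_nil] at h1
      obtain ⟨n, hn, e⟩ := h2 _ List.mem_cons_self
      subst h1
      have hw := (h3 n hn).1.isWord
      rw [Prod.mk.injEq] at e
      rw [e.1, e.2] at hw
      obtain ⟨φ, rfl⟩ := hw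
      refine ⟨φ, m, rfl, rfl, h3, h4, ?_⟩
      rwa [(h3 n hn).1.eq_formula_node e.2] at hn
    · simp at hx

/-- Both sides fail for words that are not formulas. For formulas, both amount to an assignment over
a model of `T` that avoids all patterns. -/
theorem ardSat_iff_formulaSat_reduction {T : L.Theory} (hT : IsIndexTheory T)
    (w : List (Symbol L)) :
    (∃ φ : AFormula L, φ.word = w ∧ ARDSat zero T φ) ↔
      ∃ χ : L.Formula ℕ, χ.IsQF ∧ formulaWord χ = reduction zero w ∧ FormulaSat T χ := by
  rcases reduction_eq (zero := zero) w with ⟨h1, h2⟩ | ⟨φ, m, rfl, h1, h2, h3, h4⟩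
  · refine iff_of_false (fun ⟨φ, h, _⟩ => h2 φ h) ?_
    rintro ⟨χ, -, h, M, v, hv⟩
    rw [h1] at h
    rw [formulaWord_injective (a₂ := .falsum) h] at hv
    exact hv
  · rw [h1, formulaSat_patternsWord_iff hT.stablyInfinite (atomValid_of_mem_patterns h2 _)]
    constructor
    · rintro ⟨φ', e, M, hM, v, hv⟩
      rw [AFormula.word_injective e] at hv
      exact ⟨M.Index, _, inferInstance, indexValue M v zero, freeValue M v, hM.index_model,
        avoids_patterns.2 (hM.laws hv h2)⟩
    · rintro ⟨I, X, _, vI, vX, hI, h⟩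
      exact ⟨φ, rfl, (avoids_patterns.1 h).ardSat hT.linearOrder hI h2 h3 h4⟩

end Reduction

end MaxDiff

/-- For every index theory `T` over an effectively presented signature `L` (the function symbols
and the relation symbols are coded by natural numbers, with computable arities), satisfiability of
quantifier-free formulas modulo the theory `ARD(T)` of arrays with maxdiff is decidable. -/
theorem mainTheorem4 (L : FirstOrder.Language.{0, 0}) [L.IsOrdered] (zero : L.Constants)
    [Primcodable (Σ n, L.Functions n)] [Primcodable (Σ n, L.Relations n)]
    (hFun : Computable fun f : Σ n, L.Functions n => f.1)
    (hRel : Computable fun R : Σ n, L.Relations n => R.1)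
    (T : L.Theory) (hT : MaxDiff.IsIndexTheory T) :
    MaxDiff.ARDSMTDecidable zero T :=
  ComputablePred.computable_of_manyOneReducible
    ⟨MaxDiff.reduction zero, MaxDiff.computable_reduction hFun hRel zero,
      MaxDiff.ardSat_iff_formulaSat_reduction hT⟩ hT.smtDecidable
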